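/- For $n\ge 1$ let $B^n=\{x\in\mathbb{R}^n:\|x\|^2\le 1\}$ be the unit ball with the probability measure $d\mu_B(x)=c\,(1-\|x\|^2)^{-1/2}dx$, and let $\Delta^n=\{x\in\mathbb{R}^n: x_i\ge 0,\ \sum_i x_i\le 1\}$ be the standard simplex with the probability measure $d\mu_\Delta(x)=c'\,x_1^{-1/2}\cdots x_n^{-1/2}(1-\sum_i x_i)^{-1/2}dx$ ($c,c'>0$ normalization constants). For $X=B^n$ or $X=\Delta^n$, with its measure $\mu$, let $H_k$ be the space of real polynomials in $n$ variables of degree at most $k$ that are orthogonal in $L^2(\mu)$ to all polynomials of degree at most $k-1$. Every polynomial $p$ of degree at most $d$ has a unique decomposition $p=\sum_{k=0}^d p_k$ with $p_k\in H_k$. With $\|p\|_X=\max_{x\in X}|p(x)|$, define the harmonic constant $$\gamma(X)_d=\max_{0\ne p,\ \deg p\le d}\ \max_{0\le k\le d}\frac{\|p_k\|_X}{\|p\|_X},$$ where the maximum exists (and is finite). Then $\gamma(B^n)_d$ and $\gamma(\Delta^n)_d$ depend polynomially on $n$ for fixed $d$ and polynomially on $d$ for fixed $n$; that is, for every $d\ge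 0$ they are bounded from above, for all $n\ge 1$, by a polynomial in $n$, and for every $n\ge 1$ they are bounded from above, for all $d\ge 0$, by a polynomial in $d$. Explicitly, for $n\ge 2$ let $w_n(x)=c_n(1-x^2)^{(n-2)/2}$, where $c_n>0$ is such that $\int_{-1}^1 w_n=1$, let $\widehat G_k$ be the orthonormal polynomial of degree $k$ for the weight $w_n$ on $[-1,1]$, and let $G_k(x)=\widehat G_k(1)\widehat G_k(x)$ (Gegenbauer polynomials). Then for all $d\ge 0$ $$\gamma(B^n)_d^2\le\max_{0\le k\le d}G_k(1),\qquad \gamma(\Delta^n)_d^2\le\max_{0\le k\le d}G_{2k}(1),$$ and for all $k\ge 0$ $$G_k(1)=\Bigl(1+\frac{2k}{n-1}\Bigr)\binom{k+n-2}{k}.$$ -/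

import Mathlib

open MeasureTheory

noncomputable section

/-- The unit ball `Bⁿ = {x ∈ ℝⁿ : ‖x‖² ≤ 1}` for the Euclidean norm. -/
def unitBall (n : ℕ) : Set (Fin n → ℝ) := {x | ∑ i, x i ^ 2 ≤ 1}

/-- The standard simplex `Δⁿ = {x ∈ ℝⁿ : xᵢ ≥ 0, 1 - ∑ xᵢ ≥ 0}` (full-dimensional in `ℝⁿ`). -/
def solidSimplex (n : ℕ) : Set (Fin n → ℝ) := {x | (∀ i, 0 ≤ x i) ∧ 0 ≤ 1 - ∑ i, x i}

/-- The measure `c · w(x) dx` on `X`, where `c` normalizes the total mass to `1`. -/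
def weightedProb {n : ℕ} (X : Set (Fin n → ℝ)) (w : (Fin n → ℝ) → ℝ) : Measure (Fin n → ℝ) :=
  (∫⁻ x in X, ENNReal.ofReal (w x))⁻¹ •
    (volume.restrict X).withDensity (fun x => ENNReal.ofReal (w x))

/-- `dμ_B(x) = c (1 - ‖x‖²)^(-1/2) dx` on the unit ball. -/
def ballMeasure (n : ℕ) : Measure (Fin n → ℝ) :=
  weightedProb (unitBall n) (fun x => (1 - ∑ i, x i ^ 2) ^ (-(1 / 2) : ℝ))

/-- `dμ_Δ(x) = c x₁^(-1/2) ⋯ xₙ^(-1/2) (1 - ∑ xᵢ)^(-1/2) dx` on the standard simplex. -/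
def simplexMeasure (n : ℕ) : Measure (Fin n → ℝ) :=
  weightedProb (solidSimplex n)
    (fun x => (∏ i, x i ^ (-(1 / 2) : ℝ)) * (1 - ∑ i, x i) ^ (-(1 / 2) : ℝ))

/-- The sup-norm `max_{x ∈ X} |p(x)|` of a polynomial on a (nonempty, compact) set `X`. -/
def supNormOn {n : ℕ} (X : Set (Fin n → ℝ)) (p : MvPolynomial (Fin n) ℝ) : ℝ :=
  sSup ((fun x => |MvPolynomial.eval x p|) '' X)

/-- The space `H_k` of polynomials of degree at most `k` that are orthogonal, in `L²(μ)`, to every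
polynomial of degree at most `k - 1`. -/
def orthSpace {n : ℕ} (μ : Measure (Fin n → ℝ)) (k : ℕ) : Set (MvPolynomial (Fin n) ℝ) :=
  {p | p.totalDegree ≤ k ∧ ∀ q : MvPolynomial (Fin n) ℝ, q.totalDegree < k →
    ∫ x, MvPolynomial.eval x p * MvPolynomial.eval x q ∂μ = 0}

/-- `c 0, …, c d` are the components of `p`: `c k ∈ H_k` and `p = ∑_{k ≤ d} c k` on `X`. -/
def IsOrthDecomp {n : ℕ} (X : Set (Fin n → ℝ)) (μ : Measure (Fin n → ℝ)) (d : ℕ)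
    (p : MvPolynomial (Fin n) ℝ) (c : Fin (d + 1) → MvPolynomial (Fin n) ℝ) : Prop :=
  (∀ k : Fin (d + 1), c k ∈ orthSpace μ (k : ℕ)) ∧
    ∀ x ∈ X, MvPolynomial.eval x p = ∑ k, MvPolynomial.eval x (c k)

/-- The set of all ratios `‖p_k‖_X / ‖p‖_X`, for `p` of degree at most `d` that does not vanish
identically on `X` and `0 ≤ k ≤ d`. -/
def harmonicRatios {n : ℕ} (X : Set (Fin n → ℝ)) (μ : Measure (Fin n → ℝ)) (d : ℕ) : Set ℝ :=
  {r | ∃ (p : MvPolynomial (Fin n) ℝ) (c : Fin (d + 1) → MvPolynomial (Fin n) ℝ)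
      (k : Fin (d + 1)), p.totalDegree ≤ d ∧ (∃ x ∈ X, MvPolynomial.eval x p ≠ 0) ∧
        IsOrthDecomp X μ d p c ∧ r = supNormOn X (c k) / supNormOn X p}

/-- The harmonic constant `γ(X)_d` of `X` equipped with `μ`. -/
def harmonicConst {n : ℕ} (X : Set (Fin n → ℝ)) (μ : Measure (Fin n → ℝ)) (d : ℕ) : ℝ :=
  sSup (harmonicRatios X μ d)

/-- The normalized Gegenbauer weight `c_n (1 - x²)^((n-2)/2)` on `[-1, 1]`. -/
def gegenbauerWeight (n : ℕ) (x : ℝ) : ℝ :=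
  (∫ t in (-1 : ℝ)..1, (1 - t ^ 2) ^ (((n : ℝ) - 2) / 2))⁻¹ * (1 - x ^ 2) ^ (((n : ℝ) - 2) / 2)

/-- The inner product of univariate polynomials for the Gegenbauer weight. -/
def gegenbauerInner (n : ℕ) (p q : Polynomial ℝ) : ℝ :=
  ∫ x in (-1 : ℝ)..1, p.eval x * q.eval x * gegenbauerWeight n x

/-- The monic Gegenbauer polynomials, by Gram-Schmidt orthogonalization of `1, x, x², …`. -/
def gegenbauerMonic (n : ℕ) (k : ℕ) : Polynomial ℝ :=
  Polynomial.X ^ k - ∑ j : Fin k,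
    Polynomial.C (gegenbauerInner n (Polynomial.X ^ k) (gegenbauerMonic n (j : ℕ)) /
      gegenbauerInner n (gegenbauerMonic n (j : ℕ)) (gegenbauerMonic n (j : ℕ))) *
        gegenbauerMonic n (j : ℕ)
termination_by k
decreasing_by all_goals exact j.isLt

/-- The orthonormal Gegenbauer polynomial `Ĝ_k` of degree `k`. -/
def gegenbauerOrthonormal (n : ℕ) (k : ℕ) : Polynomial ℝ :=
  Polynomial.C (Real.sqrt (gegenbauerInner n (gegenbauerMonic n k) (gegenbauerMonic n k)))⁻¹ *
    gegenbauerMonic n k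

/-- The Gegenbauer polynomial `G_k = Ĝ_k(1) Ĝ_k`. -/
def gegenbauer (n : ℕ) (k : ℕ) : Polynomial ℝ :=
  Polynomial.C ((gegenbauerOrthonormal n k).eval 1) * gegenbauerOrthonormal n k

end

/-! Everything reduces to comparing the sup norm with the L² norm on each `H_k`. If `q(x)² ≤ M
‖q‖₂²` for all `q ∈ H_k`, `k ≤ d`, `x ∈ X`, then `‖p_k‖_X² ≤ M ‖p_k‖₂² ≤ M ‖p‖₂² ≤ M ‖p‖_X²`: the
middle step is orthogonality of the components, the last one holds because the measure is a
probability (`sq_le_of_mem_harmonicRatios`). So the squared harmonic constant is at most `M`.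

For the ball, `M` comes from the sphere `Sⁿ ⊆ ℝⁿ⁺¹`: the weight `(1 - ‖x‖²)^(-1/2)` is what the
uniform measure of `Sⁿ` becomes when one coordinate is forgotten. An element of `H_k` contains only
monomials whose degree has the parity of `k`, so multiplying by powers of `‖u‖²` makes it a
homogeneous polynomial `Q` of degree `k` on `ℝⁿ⁺¹` with the same values on the sphere, still
orthogonal to lower degrees. Such a `Q` is reproduced by zonal polynomials: the mean of `Q ·
P_k(⟨e,·⟩)` is `zonalNorm n k * Q(e)`, where `P_k` is the Gegenbauer polynomial with `P_k(1) = 1`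
(`sphereMean_mul_zonal`). Cauchy-Schwarz then gives `M = (zonalNorm n k)⁻¹`
(`eval_sq_le_of_orthogonal`), which equals `G_k(1)` for `n ≥ 2` (`gegenbauer_eval_one_eq`).

The simplex is the image of the ball under `x ↦ (xᵢ²)`, which carries one measure to the other
(`integral_simplex_eq`). Substituting squares sends `H_k` of the simplex into `H_{2k}` of the ball
(`expand_mem_orthSpace_ball`), hence the index `2k`.

No rotation invariance is used. The sphere mean is defined as a ball integral, computed on monomials
by Gamma functions, and then handled through one identity, integration by parts against a linear
form (`sphereMean_linForm_mul`). Likewise `P_k` is studied through a moment functional. That algebra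
works for all `n ≥ 1`, including `n = 1`, where `P_k` is a Chebyshev polynomial; the integral
against `gegenbauerWeight` enters only for `n ≥ 2`. -/

/-! ### Zonal polynomials: orthogonality and norms from a moment functional. -/

noncomputable section

/-- The moments of a coordinate of a uniformly distributed point of the sphere `Sⁿ ⊆ ℝⁿ⁺¹`. -/
def sphereMoment (n : ℕ) : ℕ → ℝ
  | 0 => 1
  | 1 => 0
  | m + 2 => ((m : ℝ) + 1) / ((n : ℝ) + m + 1) * sphereMoment n m

/-- The linear functional on univariate polynomials with the moments `sphereMoment n`. -/
def zonalFunctional (n : ℕ) : Polynomial ℝ →ₗ[ℝ] ℝ :=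
  (Polynomial.basisMonomials ℝ).constr ℝ (sphereMoment n)

theorem zonalFunctional_X_pow (n m : ℕ) :
    zonalFunctional n (Polynomial.X ^ m) = sphereMoment n m := by
  have := (Polynomial.basisMonomials ℝ).constr_basis ℝ (sphereMoment n) m
  simpa only [zonalFunctional, Polynomial.coe_basisMonomials, ← Polynomial.X_pow_eq_monomial]
    using this

/-- The Gegenbauer polynomials with value `1` at the point `1`. -/
def zonalPoly (n : ℕ) : ℕ → Polynomial ℝ
  | 0 => 1
  | 1 => Polynomial.X
  | k + 2 => Polynomial.C (((n : ℝ) + 2 * k + 1) / (n + k)) * (Polynomial.X * zonalPoly n (k + 1))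
      - Polynomial.C (((k : ℝ) + 1) / (n + k)) * zonalPoly n k

theorem zonalPoly_eval_one {n : ℕ} (hn : 1 ≤ n) (k : ℕ) : (zonalPoly n k).eval 1 = 1 := by
  induction k using Nat.twoStepInduction with
  | zero => simp [zonalPoly]
  | one => simp [zonalPoly]
  | more k h0 h1 =>
    have : (n : ℝ) + k ≠ 0 := by positivity
    simp [zonalPoly, h0, h1]
    field_simp
    ring

theorem zonalFunctional_C_mul (n : ℕ) (a : ℝ) (p : Polynomial ℝ) :
    zonalFunctional n (Polynomial.C a * p) = a * zonalFunctional n p := by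
  rw [← Polynomial.smul_eq_C_mul, map_smul, smul_eq_mul]

theorem zonalFunctional_step (n k m : ℕ) :
    zonalFunctional n (zonalPoly n (k + 2) * Polynomial.X ^ m) =
      ((n : ℝ) + 2 * k + 1) / (n + k) *
          zonalFunctional n (zonalPoly n (k + 1) * Polynomial.X ^ (m + 1)) -
        ((k : ℝ) + 1) / (n + k) * zonalFunctional n (zonalPoly n k * Polynomial.X ^ m) := by
  rw [← zonalFunctional_C_mul, ← zonalFunctional_C_mul, ← map_sub, zonalPoly]
  congr 1
  ring

theorem sphereMoment_odd (n m : ℕ) : sphereMoment n (2 * m + 1) = 0 := by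
  induction m with
  | zero => simp [sphereMoment]
  | succ m ih =>
    rw [show 2 * (m + 1) + 1 = (2 * m + 1) + 2 by ring, sphereMoment, ih, mul_zero]

/-- The odd moments vanish and `zonalPoly n k` has the parity of `k`. -/
theorem zonalFunctional_parity (n k : ℕ) : ∀ m : ℕ, Odd (k + m) →
    zonalFunctional n (zonalPoly n k * Polynomial.X ^ m) = 0 := by
  induction k using Nat.twoStepInduction with
  | zero =>
    rintro m ⟨j, hj⟩
    have : m = 2 * j + 1 := by omega
    simp [zonalPoly, zonalFunctional_X_pow, this, sphereMoment_odd]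
  | one =>
    rintro m ⟨j, hj⟩
    rw [zonalPoly, ← pow_succ', zonalFunctional_X_pow, show m + 1 = 2 * j + 1 by omega,
      sphereMoment_odd]
  | more k h0 h1 =>
    rintro m ⟨j, hj⟩
    rw [zonalFunctional_step, h0 m ⟨j - 1, by omega⟩, h1 (m + 1) ⟨j, by omega⟩]
    ring

/-- The recursion for `zonalPoly` expresses the pairing at `(k + 2, i)` by the pairings at `(k + 1,
i + 1)` and `(k, i + 1)`. Only `i = 0` is needed later, but the induction closes only with all `i`
at once. -/
theorem zonalFunctional_diag {n : ℕ} (hn : 1 ≤ n) (k : ℕ) : ∀ i : ℕ,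
    zonalFunctional n (zonalPoly n k * Polynomial.X ^ (k + 2 * i)) *
        ∏ j ∈ Finset.range k, ((n : ℝ) + 2 * i + 2 * j + 1) =
      ((k + 2 * i).descFactorial k : ℝ) * sphereMoment n (2 * i) := by
  induction k using Nat.twoStepInduction with
  | zero => intro i; simp [zonalPoly, zonalFunctional_X_pow]
  | one =>
    intro i
    rw [zonalPoly, ← pow_succ', zonalFunctional_X_pow, show 1 + 2 * i + 1 = 2 * i + 2 by ring,
      sphereMoment]
    have : (n : ℝ) + 2 * i + 1 ≠ 0 := by positivity
    simp
    field_simp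
    ring
  | more k h0 h1 =>
    intro i
    have e0 := h0 (i + 1)
    have e1 := h1 (i + 1)
    have hnk : (n : ℝ) + k ≠ 0 := by positivity
    have hmu : sphereMoment n (2 * (i + 1)) * ((n : ℝ) + 2 * i + 1) =
        (2 * i + 1) * sphereMoment n (2 * i) := by
      have : (n : ℝ) + 2 * i + 1 ≠ 0 := by positivity
      rw [show 2 * (i + 1) = 2 * i + 2 by ring, sphereMoment]
      push_cast
      field_simp
    have hP1 : ∏ j ∈ Finset.range (k + 2), ((n : ℝ) + 2 * i + 2 * j + 1) =
        ((n : ℝ) + 2 * i + 1) *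
          ∏ j ∈ Finset.range (k + 1), ((n : ℝ) + 2 * (i + 1 : ℕ) + 2 * j + 1) := by
      rw [Finset.prod_range_succ', mul_comm]
      congr 1
      · simp
      · refine Finset.prod_congr rfl fun j _ => ?_
        push_cast; ring
    have hP2 : ∏ j ∈ Finset.range (k + 1), ((n : ℝ) + 2 * (i + 1 : ℕ) + 2 * j + 1) =
        (∏ j ∈ Finset.range k, ((n : ℝ) + 2 * (i + 1 : ℕ) + 2 * j + 1)) *
          ((n : ℝ) + 2 * i + 2 * k + 3) := by
      rw [Finset.prod_range_succ]
      congr 1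
      push_cast; ring
    have hd1 : (((k + 1 + 2 * (i + 1)).descFactorial (k + 1) : ℕ) : ℝ) =
        ((k : ℝ) + 2 * i + 3) * ((k + 2 * (i + 1)).descFactorial k : ℕ) := by
      rw [show k + 1 + 2 * (i + 1) = (k + 2 * (i + 1)) + 1 by ring,
        Nat.succ_descFactorial_succ]
      push_cast; ring
    have hd2 : (((k + 2 + 2 * i).descFactorial (k + 2) : ℕ) : ℝ) =
        (2 * i + 1) * (2 * i + 2) * ((k + 2 * (i + 1)).descFactorial k : ℕ) := by
      rw [show k + 2 + 2 * i = k + 2 * (i + 1) by ring, Nat.descFactorial_succ,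
        Nat.descFactorial_succ, show k + 2 * (i + 1) - (k + 1) = 2 * i + 1 by omega,
        show k + 2 * (i + 1) - k = 2 * i + 2 by omega]
      push_cast; ring
    rw [hd1] at e1
    rw [hd2, zonalFunctional_step, hP1, show k + 2 + 2 * i + 1 = k + 1 + 2 * (i + 1) by ring,
      show k + 2 + 2 * i = k + 2 * (i + 1) by ring]
    set T1 := zonalFunctional n (zonalPoly n (k + 1) * Polynomial.X ^ (k + 1 + 2 * (i + 1)))
    set T0 := zonalFunctional n (zonalPoly n k * Polynomial.X ^ (k + 2 * (i + 1)))
    set P1 := ∏ j ∈ Finset.range (k + 1), ((n : ℝ) + 2 * (i + 1 : ℕ) + 2 * j + 1)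
    set P0 := ∏ j ∈ Finset.range k, ((n : ℝ) + 2 * (i + 1 : ℕ) + 2 * j + 1)
    set d : ℝ := (((k + 2 * (i + 1)).descFactorial k : ℕ) : ℝ)
    set s : ℝ := sphereMoment n (2 * (i + 1))
    have f1 : T1 * (((n : ℝ) + 2 * i + 1) * P1) =
        (k + 2 * i + 3) * d * ((2 * i + 1) * sphereMoment n (2 * i)) := by
      rw [← hmu]; linear_combination ((n : ℝ) + 2 * i + 1) * e1
    have f0 : T0 * (((n : ℝ) + 2 * i + 1) * P1) =
        d * ((2 * i + 1) * sphereMoment n (2 * i)) * (n + 2 * i + 2 * k + 3) := by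
      rw [← hmu, hP2]; linear_combination ((n : ℝ) + 2 * i + 1) * (n + 2 * i + 2 * k + 3) * e0
    rw [sub_mul, mul_assoc, mul_assoc _ T0, f1, f0]
    field_simp
    ring

theorem zonalFunctional_diag_self {n : ℕ} (hn : 1 ≤ n) (k : ℕ) :
    zonalFunctional n (zonalPoly n k * Polynomial.X ^ k) *
      ∏ j ∈ Finset.range k, ((n : ℝ) + 2 * j + 1) = k.factorial := by
  simpa [sphereMoment, Nat.descFactorial_self] using zonalFunctional_diag hn k 0

theorem zonalFunctional_diag_succ {n : ℕ} (hn : 1 ≤ n) (k : ℕ) :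
    ((n : ℝ) + 2 * k + 1) * zonalFunctional n (zonalPoly n (k + 1) * Polynomial.X ^ (k + 1)) =
      (k + 1) * zonalFunctional n (zonalPoly n k * Polynomial.X ^ k) := by
  have e0 := zonalFunctional_diag_self hn k
  have e1 := zonalFunctional_diag_self hn (k + 1)
  have hP : 0 < ∏ j ∈ Finset.range k, ((n : ℝ) + 2 * j + 1) :=
    Finset.prod_pos fun j _ => by positivity
  rw [Finset.prod_range_succ, Nat.factorial_succ] at e1
  push_cast at e1
  apply mul_right_cancel₀ hP.ne'
  linear_combination e1 - ((k : ℝ) + 1) * e0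

theorem zonalFunctional_diag_pos {n : ℕ} (hn : 1 ≤ n) (k : ℕ) :
    0 < zonalFunctional n (zonalPoly n k * Polynomial.X ^ k) := by
  have e0 := zonalFunctional_diag_self hn k
  have hP : 0 < ∏ j ∈ Finset.range k, ((n : ℝ) + 2 * j + 1) :=
    Finset.prod_pos fun j _ => by positivity
  refine pos_of_mul_pos_left ?_ hP.le
  rw [e0]
  positivity

/-- In the three-term recursion, exponents `m < k` are covered by induction and `m = k + 1` by
parity. In the remaining case `m = k` the two terms cancel exactly by `zonalFunctional_diag_succ`.
-/
theorem zonalFunctional_orth {n : ℕ} (hn : 1 ≤ n) (k : ℕ) : ∀ m < k,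
    zonalFunctional n (zonalPoly n k * Polynomial.X ^ m) = 0 := by
  induction k using Nat.twoStepInduction with
  | zero => intro m hm; omega
  | one =>
    intro m hm
    exact zonalFunctional_parity n 1 m ⟨0, by omega⟩
  | more k h0 h1 =>
    intro m hm
    rcases lt_trichotomy m k with h | rfl | h
    · rw [zonalFunctional_step, h0 m h, h1 (m + 1) (by omega)]
      ring
    · have := zonalFunctional_diag_succ hn m
      have hnk : (n : ℝ) + m ≠ 0 := by positivity
      rw [zonalFunctional_step]
      field_simp
      linear_combination this
    · exact zonalFunctional_parity n (k + 2) m ⟨k + 1, by omega⟩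

/-- The leading coefficient of `zonalPoly n k`. -/
def zonalLead (n k : ℕ) : ℝ := (zonalPoly n k).coeff k

theorem zonalPoly_natDegree_le (n k : ℕ) : (zonalPoly n k).natDegree ≤ k := by
  induction k using Nat.twoStepInduction with
  | zero => simp [zonalPoly]
  | one => simp [zonalPoly]
  | more k h0 h1 =>
    rw [zonalPoly]
    refine (Polynomial.natDegree_sub_le _ _).trans (max_le ?_ ?_)
    · refine (Polynomial.natDegree_C_mul_le _ _).trans (Polynomial.natDegree_mul_le.trans ?_)
      have := Polynomial.natDegree_X_le (R := ℝ)
      omega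
    · exact (Polynomial.natDegree_C_mul_le _ _).trans (by omega)

theorem zonalLead_zero (n : ℕ) : zonalLead n 0 = 1 := by simp [zonalLead, zonalPoly]

theorem zonalLead_one (n : ℕ) : zonalLead n 1 = 1 := by simp [zonalLead, zonalPoly]

theorem zonalLead_succ (n k : ℕ) :
    zonalLead n (k + 2) = ((n : ℝ) + 2 * k + 1) / (n + k) * zonalLead n (k + 1) := by
  have := zonalPoly_natDegree_le n k
  rw [zonalLead, zonalPoly, Polynomial.coeff_sub, Polynomial.coeff_C_mul, Polynomial.coeff_C_mul,
    Polynomial.coeff_X_mul, Polynomial.coeff_eq_zero_of_natDegree_lt (p := zonalPoly n k) (by omega),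
    zonalLead]
  ring

theorem zonalLead_pos {n : ℕ} (hn : 1 ≤ n) (k : ℕ) : 0 < zonalLead n k := by
  induction k using Nat.twoStepInduction with
  | zero => simp [zonalLead_zero]
  | one => simp [zonalLead_one]
  | more k h0 h1 => rw [zonalLead_succ]; positivity

/-- Orthogonality kills every coefficient of `p` but the top one. -/
theorem zonalFunctional_mul_of_natDegree_le {n : ℕ} (hn : 1 ≤ n) (k : ℕ) (p : Polynomial ℝ)
    (hp : p.natDegree ≤ k) : zonalFunctional n (zonalPoly n k * p) =
      p.coeff k * zonalFunctional n (zonalPoly n k * Polynomial.X ^ k) := by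
  conv_lhs => rw [p.as_sum_range_C_mul_X_pow' (Nat.lt_succ_of_le hp)]
  rw [Finset.mul_sum, map_sum, Finset.sum_range_succ, Finset.sum_eq_zero, zero_add, mul_left_comm,
    zonalFunctional_C_mul]
  intro i hi
  rw [mul_left_comm, zonalFunctional_C_mul, zonalFunctional_orth hn k i (Finset.mem_range.1 hi),
    mul_zero]

/-- The squared norm of `zonalPoly n k`. -/
def zonalNorm (n k : ℕ) : ℝ := zonalFunctional n (zonalPoly n k * zonalPoly n k)

theorem zonalNorm_eq {n : ℕ} (hn : 1 ≤ n) (k : ℕ) : zonalNorm n k =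
    zonalLead n k * zonalFunctional n (zonalPoly n k * Polynomial.X ^ k) :=
  zonalFunctional_mul_of_natDegree_le hn k _ (zonalPoly_natDegree_le n k)

theorem zonalNorm_pos {n : ℕ} (hn : 1 ≤ n) (k : ℕ) : 0 < zonalNorm n k := by
  rw [zonalNorm_eq hn]
  exact mul_pos (zonalLead_pos hn k) (zonalFunctional_diag_pos hn k)

theorem zonalNorm_zero (n : ℕ) : zonalNorm n 0 = 1 := by
  have := zonalFunctional_X_pow n 0
  simpa [zonalNorm, zonalPoly, sphereMoment] using this

theorem zonalNorm_one (n : ℕ) : zonalNorm n 1 = 1 / (n + 1) := by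
  have := zonalFunctional_X_pow n 2
  simpa [zonalNorm, zonalPoly, sphereMoment, ← sq] using this

/-- The norm is leading coefficient times diagonal pairing, and each factor has a one-step
recursion. -/
theorem zonalNorm_succ {n : ℕ} (hn : 1 ≤ n) (k : ℕ) : (zonalNorm n (k + 2))⁻¹ =
    (zonalNorm n (k + 1))⁻¹ * (((n : ℝ) + k) * (n + 2 * k + 3) / ((n + 2 * k + 1) * (k + 2))) := by
  have e := zonalFunctional_diag_succ hn (k + 1)
  have h1 := zonalFunctional_diag_pos hn (k + 1)
  have h2 := zonalFunctional_diag_pos hn (k + 2)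
  have h3 := zonalLead_pos hn (k + 1)
  have hnk : (0 : ℝ) < (n : ℝ) + k := by positivity
  rw [zonalNorm_eq hn, zonalNorm_eq hn, zonalLead_succ]
  push_cast at e
  have e' : zonalFunctional n (zonalPoly n (k + 2) * Polynomial.X ^ (k + 2)) =
      (k + 2) / (n + 2 * k + 3) *
        zonalFunctional n (zonalPoly n (k + 1) * Polynomial.X ^ (k + 1)) := by
    field_simp
    linear_combination e
  rw [e']
  field_simp

theorem zonalNorm_inv_eq {n : ℕ} (hn : 2 ≤ n) (k : ℕ) : (zonalNorm n k)⁻¹ =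
    (1 + 2 * (k : ℝ) / ((n : ℝ) - 1)) * ((k + n - 2).choose k : ℝ) := by
  obtain ⟨n, rfl⟩ := Nat.exists_eq_add_of_le' hn
  induction k using Nat.twoStepInduction with
  | zero => simp [zonalNorm_zero]
  | one =>
    rw [zonalNorm_one]
    have : (n : ℝ) + 1 ≠ 0 := by positivity
    have h2 : ((n + 2 : ℕ) : ℝ) - 1 = n + 1 := by push_cast; ring
    rw [h2, show 1 + (n + 2) - 2 = n + 1 by omega]
    simp
    field_simp
    ring
  | more k h0 h1 =>
    rw [zonalNorm_succ (by omega), h1]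
    have h2 : ((n + 2 : ℕ) : ℝ) - 1 = n + 1 := by push_cast; ring
    have h3 : k + 2 + (n + 2) - 2 = (k + 1 + (n + 2) - 2) + 1 := by omega
    have h4 : k + 1 + (n + 2) - 2 = k + 1 + n := by omega
    have hc := Nat.add_one_mul_choose_eq (k + 1 + n) (k + 1)
    rw [h2, h3, h4]
    have hc' : ((k + 1 + n + 1).choose (k + 2) : ℝ) =
        (k + 1 + n + 1) * (k + 1 + n).choose (k + 1) / (k + 2) := by
      rw [eq_div_iff (by positivity)]
      exact_mod_cast by linarith
    rw [hc']
    push_cast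
    field_simp
    ring

/-- A bound free of the denominator `n - 1`, hence valid for `n = 1` too. It serves for the
polynomial bounds. -/
theorem zonalNorm_inv_le {n : ℕ} (hn : 1 ≤ n) (k : ℕ) :
    (zonalNorm n k)⁻¹ ≤ ((n + k).choose k : ℝ) := by
  induction k using Nat.twoStepInduction with
  | zero => simp [zonalNorm_zero]
  | one => simp [zonalNorm_one]
  | more k h0 h1 =>
    rw [zonalNorm_succ hn]
    have hc := Nat.add_one_mul_choose_eq (n + (k + 1)) (k + 1)
    have hc' : ((n + (k + 2)).choose (k + 2) : ℝ) =
        (n + (k + 1)).choose (k + 1) * ((n + k + 2) / (k + 2)) := by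
      rw [← mul_div_assoc, eq_div_iff (by positivity)]
      have : (n + (k + 2)).choose (k + 2) * (k + 2) =
        (n + (k + 1)).choose (k + 1) * (n + k + 2) := by
        rw [show n + (k + 2) = n + (k + 1) + 1 by ring, ← hc]; ring
      exact_mod_cast this
    rw [hc']
    refine mul_le_mul h1 ?_ (by positivity) (by positivity)
    rw [div_le_div_iff₀ (by positivity) (by positivity)]
    -- The right side exceeds the left by `2 * (k + 1)`. This compares the growth factor of
    -- `(zonalNorm n k)⁻¹` with that of the binomial coefficient.
    have : ((n : ℝ) + k) * (n + 2 * k + 3) ≤ (n + k + 2) * (n + 2 * k + 1) := by nlinarith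
    nlinarith [mul_le_mul_of_nonneg_right this (by positivity : (0 : ℝ) ≤ k + 2)]

end

/-! ### Identification with the Gegenbauer polynomials of the weight `gegenbauerWeight`. -/

noncomputable section

theorem continuous_one_sub_sq_rpow {a : ℝ} (ha : 0 ≤ a) :
    Continuous fun x : ℝ => (1 - x ^ 2) ^ a :=
  Continuous.rpow_const (by fun_prop) fun _ => Or.inr ha

theorem hasDerivAt_one_sub_sq_rpow {a : ℝ} (ha : 0 ≤ a) (x : ℝ) :
    HasDerivAt (fun x : ℝ => (1 - x ^ 2) ^ (a + 1)) (-(2 * (a + 1)) * (x * (1 - x ^ 2) ^ a)) x := by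
  have h1 : HasDerivAt (fun x : ℝ => 1 - x ^ 2) (-(2 * x)) x := by
    simpa using (hasDerivAt_pow 2 x).const_sub 1
  convert h1.rpow_const (p := a + 1) (Or.inr (by linarith)) using 1
  rw [add_sub_cancel_right]
  ring

theorem integral_mul_one_sub_sq_rpow {a : ℝ} (ha : 0 ≤ a) :
    ∫ x in (-1 : ℝ)..1, x * (1 - x ^ 2) ^ a = 0 := by
  have hc := continuous_one_sub_sq_rpow ha
  have h := intervalIntegral.integral_eq_sub_of_hasDerivAt
    (fun x (_ : x ∈ Set.uIcc (-1 : ℝ) 1) => hasDerivAt_one_sub_sq_rpow ha x)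
    (Continuous.intervalIntegrable (by fun_prop) _ _)
  rw [intervalIntegral.integral_const_mul] at h
  have h0 : a + 1 ≠ 0 := by linarith
  simp only [one_pow, sub_self, Real.zero_rpow h0, even_two, Even.neg_pow] at h
  exact (mul_eq_zero.1 h).resolve_left (by simpa using h0)

/-- Integrate the derivative of `x ^ (m + 1) * (1 - x ^ 2) ^ (a + 1)`, which vanishes at both
endpoints. -/
theorem integral_pow_mul_one_sub_sq_rpow {a : ℝ} (ha : 0 ≤ a) (m : ℕ) :
    (2 * a + m + 3) * ∫ x in (-1 : ℝ)..1, x ^ (m + 2) * (1 - x ^ 2) ^ a =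
      (m + 1) * ∫ x in (-1 : ℝ)..1, x ^ m * (1 - x ^ 2) ^ a := by
  have hc := continuous_one_sub_sq_rpow ha
  have h := intervalIntegral.integral_eq_sub_of_hasDerivAt
    (fun x (_ : x ∈ Set.uIcc (-1 : ℝ) 1) =>
      (hasDerivAt_pow (m + 1) x).mul (hasDerivAt_one_sub_sq_rpow ha x))
    (Continuous.intervalIntegrable (by
      have := continuous_one_sub_sq_rpow (a := a + 1) (by linarith)
      fun_prop) _ _)
  have h0 : a + 1 ≠ 0 := by linarith
  simp only [Pi.mul_apply, one_pow, sub_self, Real.zero_rpow h0, even_two, Even.neg_pow,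
    mul_zero] at h
  rw [← intervalIntegral.integral_const_mul, ← intervalIntegral.integral_const_mul, ← sub_eq_zero,
    ← intervalIntegral.integral_sub, ← neg_eq_zero, ← intervalIntegral.integral_neg, ← h]
  · refine intervalIntegral.integral_congr fun x hx => ?_
    rw [Set.uIcc_of_le (by norm_num)] at hx
    have hx2 : 0 ≤ 1 - x ^ 2 := by nlinarith [hx.1, hx.2]
    rw [Real.rpow_add_one' hx2 h0]
    push_cast
    ring
  · exact Continuous.intervalIntegrable (by fun_prop) _ _
  · exact Continuous.intervalIntegrable (by fun_prop) _ _

theorem integral_one_sub_sq_rpow_pos {a : ℝ} (ha : 0 ≤ a) :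
    0 < ∫ x in (-1 : ℝ)..1, (1 - x ^ 2) ^ a := by
  refine intervalIntegral.intervalIntegral_pos_of_pos_on
    ((continuous_one_sub_sq_rpow ha).intervalIntegrable _ _) (fun x hx => ?_) (by norm_num)
  have : 0 < 1 - x ^ 2 := by nlinarith [hx.1, hx.2]
  positivity

theorem continuous_gegenbauerWeight {n : ℕ} (hn : 2 ≤ n) : Continuous (gegenbauerWeight n) := by
  have h2 : (2 : ℝ) ≤ n := by exact_mod_cast hn
  have := continuous_one_sub_sq_rpow (a := ((n : ℝ) - 2) / 2) (by linarith)
  unfold gegenbauerWeight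
  fun_prop

/-- With `a = (n - 2) / 2` the factor `2a + m + 3` is `n + m + 1`, so the moments of the weight obey
the recursion defining `sphereMoment`. The condition `2 ≤ n` makes `a ≥ 0` and the weight
continuous. -/
theorem integral_pow_mul_gegenbauerWeight {n : ℕ} (hn : 2 ≤ n) (m : ℕ) :
    ∫ x in (-1 : ℝ)..1, x ^ m * gegenbauerWeight n x = sphereMoment n m := by
  have h2 : (2 : ℝ) ≤ n := by exact_mod_cast hn
  have ha : 0 ≤ ((n : ℝ) - 2) / 2 := by linarith
  have hpos := integral_one_sub_sq_rpow_pos ha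
  have key : ∀ m : ℕ, ∫ x in (-1 : ℝ)..1, x ^ m * gegenbauerWeight n x =
      (∫ t in (-1 : ℝ)..1, (1 - t ^ 2) ^ (((n : ℝ) - 2) / 2))⁻¹ *
        ∫ x in (-1 : ℝ)..1, x ^ m * (1 - x ^ 2) ^ (((n : ℝ) - 2) / 2) := by
    intro m
    rw [← intervalIntegral.integral_const_mul]
    refine intervalIntegral.integral_congr fun x _ => ?_
    simp only [gegenbauerWeight]
    ring
  induction m using Nat.twoStepInduction with
  | zero =>
    rw [key]
    simp only [pow_zero, one_mul, sphereMoment]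
    exact inv_mul_cancel₀ hpos.ne'
  | one =>
    rw [key]
    simp only [pow_one, sphereMoment, integral_mul_one_sub_sq_rpow ha, mul_zero]
  | more m h0 h1 =>
    have e := integral_pow_mul_one_sub_sq_rpow ha m
    have hd : (n : ℝ) + m + 1 ≠ 0 := by positivity
    rw [sphereMoment, ← h0, key, key, div_mul_eq_mul_div, eq_div_iff hd]
    rw [show 2 * (((n : ℝ) - 2) / 2) + m + 3 = n + m + 1 by ring] at e
    linear_combination
      (∫ t in (-1 : ℝ)..1, (1 - t ^ 2) ^ (((n : ℝ) - 2) / 2))⁻¹ * e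

theorem integral_mul_gegenbauerWeight {n : ℕ} (hn : 2 ≤ n) (p : Polynomial ℝ) :
    ∫ x in (-1 : ℝ)..1, p.eval x * gegenbauerWeight n x = zonalFunctional n p := by
  have hw := continuous_gegenbauerWeight hn
  induction p using Polynomial.induction_on' with
  | add p q hp hq =>
    rw [map_add, ← hp, ← hq, ← intervalIntegral.integral_add]
    · refine intervalIntegral.integral_congr fun x _ => ?_
      simp only [Polynomial.eval_add]
      ring
    · exact Continuous.intervalIntegrable (by fun_prop) _ _
    · exact Continuous.intervalIntegrable (by fun_prop) _ _
  | monomial m a =>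
    rw [← Polynomial.C_mul_X_pow_eq_monomial, zonalFunctional_C_mul, zonalFunctional_X_pow,
      ← integral_pow_mul_gegenbauerWeight hn, ← intervalIntegral.integral_const_mul]
    refine intervalIntegral.integral_congr fun x _ => ?_
    simp only [Polynomial.eval_mul, Polynomial.eval_C, Polynomial.eval_pow, Polynomial.eval_X]
    ring

theorem gegenbauerInner_eq {n : ℕ} (hn : 2 ≤ n) (p q : Polynomial ℝ) :
    gegenbauerInner n p q = zonalFunctional n (p * q) := by
  rw [← integral_mul_gegenbauerWeight hn, gegenbauerInner]
  simp only [Polynomial.eval_mul]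

/-- A polynomial of degree less than `k` that is orthogonal to the first `k` zonal polynomials
vanishes. -/
theorem eq_zero_of_zonalFunctional_eq_zero {n : ℕ} (hn : 1 ≤ n) {k : ℕ} {p : Polynomial ℝ}
    (hp : p.degree < k) (h : ∀ j < k, zonalFunctional n (zonalPoly n j * p) = 0) : p = 0 := by
  by_contra h0
  have hd : p.natDegree < k := (Polynomial.natDegree_lt_iff_degree_lt h0).2 hp
  have := h _ hd
  rw [zonalFunctional_mul_of_natDegree_le hn _ _ le_rfl] at this
  rcases mul_eq_zero.1 this with h1 | h1
  · exact h0 (Polynomial.leadingCoeff_eq_zero.1 h1)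
  · exact (zonalFunctional_diag_pos hn _).ne' h1

theorem zonalFunctional_mul_zonalPoly_of_lt {n : ℕ} (hn : 1 ≤ n) {i j : ℕ} (hij : i < j) :
    zonalFunctional n (zonalPoly n j * zonalPoly n i) = 0 := by
  have := zonalPoly_natDegree_le n i
  rw [zonalFunctional_mul_of_natDegree_le hn _ _ (by omega),
    Polynomial.coeff_eq_zero_of_natDegree_lt (by omega), zero_mul]

theorem zonalFunctional_mul_zonalPoly_of_ne {n : ℕ} (hn : 1 ≤ n) {i j : ℕ} (hij : i ≠ j) :
    zonalFunctional n (zonalPoly n j * zonalPoly n i) = 0 := by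
  rcases lt_or_gt_of_ne hij with h | h
  · exact zonalFunctional_mul_zonalPoly_of_lt hn h
  · rw [mul_comm]
    exact zonalFunctional_mul_zonalPoly_of_lt hn h

/-- Gram-Schmidt is determined by its result: the difference of the two sides has degree below `k`,
since the leading terms cancel, and it is orthogonal to every `zonalPoly n j` with `j < k`. -/
theorem gegenbauerMonic_eq {n : ℕ} (hn : 2 ≤ n) (k : ℕ) :
    gegenbauerMonic n k = Polynomial.C (zonalLead n k)⁻¹ * zonalPoly n k := by
  have hn1 : 1 ≤ n := by omega
  induction k using Nat.strong_induction_on with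
  | _ k ih =>
    have hl : ∀ j, zonalLead n j ≠ 0 := fun j => (zonalLead_pos hn1 j).ne'
    have hsum : ∑ j : Fin k, Polynomial.C
          (gegenbauerInner n (Polynomial.X ^ k) (gegenbauerMonic n (j : ℕ)) /
            gegenbauerInner n (gegenbauerMonic n (j : ℕ)) (gegenbauerMonic n (j : ℕ))) *
          gegenbauerMonic n (j : ℕ) =
        ∑ j : Fin k, Polynomial.C (zonalFunctional n (zonalPoly n j * Polynomial.X ^ k) /
          zonalNorm n j) * zonalPoly n j := by
      refine Finset.sum_congr rfl fun j _ => ?_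
      rw [ih j j.isLt, gegenbauerInner_eq hn, gegenbauerInner_eq hn, ← mul_assoc,
        ← Polynomial.C_mul, mul_left_comm (Polynomial.X ^ k), zonalFunctional_C_mul,
        show ∀ (c : ℝ) (q : Polynomial ℝ), Polynomial.C c * q * (Polynomial.C c * q) =
          Polynomial.C c * (Polynomial.C c * (q * q)) by intros; ring,
        zonalFunctional_C_mul, zonalFunctional_C_mul, mul_comm (Polynomial.X ^ k)]
      congr 2
      have := (zonalNorm_pos hn1 j).ne'
      rw [← zonalNorm]
      field_simp [hl j]
    rw [gegenbauerMonic, hsum, ← sub_eq_zero]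
    refine eq_zero_of_zonalFunctional_eq_zero hn1 (k := k) ?_ ?_
    -- Regrouping puts `X ^ k` next to the normalized zonal polynomial, so that the terms of degree
    -- `k` cancel.
    · rw [sub_right_comm]
      refine (Polynomial.degree_sub_le _ _).trans_lt (max_lt ?_ ?_)
      · rw [Polynomial.degree_lt_iff_coeff_zero]
        intro m hm
        rw [Polynomial.coeff_sub, Polynomial.coeff_C_mul, Polynomial.coeff_X_pow]
        rcases hm.eq_or_lt with rfl | hm
        · rw [if_pos rfl, ← zonalLead, inv_mul_cancel₀ (hl _), sub_self]
        · have := zonalPoly_natDegree_le n k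
          rw [if_neg hm.ne', Polynomial.coeff_eq_zero_of_natDegree_lt (by omega)]
          simp
      · refine (Polynomial.degree_sum_le _ _).trans_lt ?_
        rw [Finset.sup_lt_iff (by exact_mod_cast WithBot.bot_lt_coe k)]
        intro j _
        rw [Polynomial.degree_lt_iff_coeff_zero]
        intro m hm
        have := zonalPoly_natDegree_le n j
        rw [Polynomial.coeff_C_mul, Polynomial.coeff_eq_zero_of_natDegree_lt (by omega), mul_zero]
    · intro j hj
      rw [mul_sub, mul_sub, map_sub, map_sub, Finset.mul_sum, map_sum,
        Finset.sum_eq_single (⟨j, hj⟩ : Fin k)]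
      · rw [mul_left_comm, zonalFunctional_C_mul, mul_left_comm, zonalFunctional_C_mul,
          zonalFunctional_mul_zonalPoly_of_ne hn1 hj.ne', ← zonalNorm,
          div_mul_cancel₀ _ (zonalNorm_pos hn1 j).ne']
        ring
      · intro i _ hi
        rw [mul_left_comm, zonalFunctional_C_mul, zonalFunctional_mul_zonalPoly_of_ne hn1, mul_zero]
        exact fun h => hi (Fin.ext h)
      · simp

/-- `G_k(1)` is the square of the orthonormal polynomial's value at `1`. The leading coefficients
cancel, and `zonalPoly n k` has value `1` at `1`. -/
theorem gegenbauer_eval_one_eq {n : ℕ} (hn : 2 ≤ n) (k : ℕ) :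
    (gegenbauer n k).eval 1 = (zonalNorm n k)⁻¹ := by
  have hn1 : 1 ≤ n := by omega
  have hl := zonalLead_pos hn1 k
  have hN := zonalNorm_pos hn1 k
  have hI : gegenbauerInner n (gegenbauerMonic n k) (gegenbauerMonic n k) =
      (zonalLead n k)⁻¹ ^ 2 * zonalNorm n k := by
    rw [gegenbauerInner_eq hn, gegenbauerMonic_eq hn,
        show ∀ (c : ℝ) (q : Polynomial ℝ), Polynomial.C c * q * (Polynomial.C c * q) =
          Polynomial.C c * (Polynomial.C c * (q * q)) by intros; ring,
        zonalFunctional_C_mul, zonalFunctional_C_mul, ← zonalNorm]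
    ring
  have hs := Real.sq_sqrt (show 0 ≤ (zonalLead n k)⁻¹ ^ 2 * zonalNorm n k by positivity)
  rw [gegenbauer, Polynomial.eval_mul, Polynomial.eval_C, ← sq, gegenbauerOrthonormal,
    Polynomial.eval_mul, Polynomial.eval_C, hI, gegenbauerMonic_eq hn, Polynomial.eval_mul,
    Polynomial.eval_C, zonalPoly_eval_one hn1, mul_pow, inv_pow, hs]
  field_simp

end

/-! ### Dirichlet integrals over the ball and the simplex. -/

noncomputable section

theorem lintegral_pi_prod_eq {n : ℕ} (f : Fin n → ℝ → ENNReal) (hf : ∀ i, Measurable (f i)) :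
    ∫⁻ x : Fin n → ℝ, ∏ i, f i (x i) = ∏ i, ∫⁻ t, f i t := by
  induction n with
  | zero => simp [volume_pi]
  | succ n ih =>
    rw [← ((volume_preserving_piFinSuccAbove (fun _ : Fin (n + 1) => ℝ) 0).symm
      ).lintegral_comp_emb (MeasurableEquiv.measurableEmbedding _), Measure.volume_eq_prod,
      Fin.prod_univ_succ, ← ih _ fun i => hf i.succ, ← lintegral_prod_mul]
    · refine lintegral_congr fun x => ?_
      simp [Fin.prod_univ_succ, MeasurableEquiv.piFinSuccAbove_symm_apply]
    · exact (hf 0).aemeasurable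
    · exact (Finset.measurable_prod _ fun i _ => (hf i.succ).comp (measurable_pi_apply i)
        ).aemeasurable

theorem lintegral_eq_lintegral_smul {n : ℕ} {r : ℝ} (hr : 0 < r) {f : (Fin n → ℝ) → ENNReal}
    (hf : Measurable f) : ∫⁻ x, f x = ENNReal.ofReal (r ^ n) * ∫⁻ x, f (r • x) := by
  rw [← lintegral_map (f := f) hf (measurable_const_smul r), Measure.map_addHaar_smul _ hr.ne',
    lintegral_smul_measure, smul_eq_mul, ← mul_assoc, ← ENNReal.ofReal_mul (by positivity),
    Module.finrank_fin_fun, abs_of_pos (by positivity), mul_inv_cancel₀ (by positivity),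
    ENNReal.ofReal_one, one_mul]

theorem lintegral_gamma {c : ℝ} (hc : 0 < c) :
    ∫⁻ t in Set.Ioi (0 : ℝ), ENNReal.ofReal (t ^ (c - 1) * Real.exp (-t)) =
      ENNReal.ofReal (Real.Gamma c) := by
  have h := Real.GammaIntegral_convergent hc
  simp only [mul_comm (Real.exp _)] at h
  rw [Real.Gamma_eq_integral hc, ← ofReal_integral_eq_lintegral_ofReal]
  · simp only [mul_comm (Real.exp _)]
  · exact h
  · refine (ae_restrict_iff' measurableSet_Ioi).2 (Filter.Eventually.of_forall fun t ht => ?_)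
    have : (0 : ℝ) < t := ht
    simp only [Pi.zero_apply]
    positivity

theorem lintegral_gamma_shift {c : ℝ} (hc : 0 < c) (s : ℝ) :
    ∫⁻ t, (if s < t then ENNReal.ofReal ((t - s) ^ (c - 1) * Real.exp (-t)) else 0) =
      ENNReal.ofReal (Real.Gamma c) * ENNReal.ofReal (Real.exp (-s)) := by
  rw [← lintegral_gamma hc, ← lintegral_mul_const' _ _ ENNReal.ofReal_ne_top,
    ← lintegral_add_right_eq_self _ s, ← lintegral_indicator measurableSet_Ioi]
  refine lintegral_congr fun t => ?_
  simp only [lt_add_iff_pos_left, Set.indicator_apply, Set.mem_Ioi]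
  split_ifs with h
  · rw [← ENNReal.ofReal_mul (by positivity), add_sub_cancel_right, neg_add, Real.exp_add]
    congr 1
    ring
  · rfl

/-- Integrate `F(x) (t - N(x))₊^(c-1) e^(-t)` over `(x, t)` in both orders. Integrating over `t`
first gives `Γ(c) e^(-N(x))`; integrating over `x` first and rescaling gives a Gamma integral times
the wanted one. The left side then factors over the coordinates when `F` is a product and `N` a sum.
-/
theorem lintegral_homogeneous {n : ℕ} {F : (Fin n → ℝ) → ENNReal} {N : (Fin n → ℝ) → ℝ}
    (hF : Measurable F) (hN : Measurable N) (hN0 : ∀ x, 0 ≤ N x) {a δ c : ℝ} (hδ : 0 < δ)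
    (hc : 0 < c) (hac : 0 < (a + n) / δ + c)
    (hFh : ∀ r : ℝ, 0 < r → ∀ x, F (r • x) = ENNReal.ofReal (r ^ a) * F x)
    (hNh : ∀ r : ℝ, 0 < r → ∀ x, N (r • x) = r ^ δ * N x) :
    ENNReal.ofReal (Real.Gamma c) * ∫⁻ x, F x * ENNReal.ofReal (Real.exp (-N x)) =
      ENNReal.ofReal (Real.Gamma ((a + n) / δ + c)) *
        ∫⁻ x, F x * (if N x < 1 then ENNReal.ofReal ((1 - N x) ^ (c - 1)) else 0) := by
  set J := ∫⁻ x, F x * (if N x < 1 then ENNReal.ofReal ((1 - N x) ^ (c - 1)) else 0) with hJ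
  set G : (Fin n → ℝ) → ℝ → ENNReal := fun x t =>
    if N x < t then ENNReal.ofReal ((t - N x) ^ (c - 1) * Real.exp (-t)) else 0 with hG
  have hGm : Measurable (Function.uncurry G) := by
    refine Measurable.ite (measurableSet_lt (hN.comp measurable_fst) measurable_snd) ?_
      measurable_const
    fun_prop
  have hGx : ∀ x, Measurable (G x) := fun x => hGm.comp (measurable_const.prodMk measurable_id)
  have hFG : ∀ t, Measurable fun x => F x * G x t := fun t =>
    hF.mul (hGm.comp (measurable_id.prodMk measurable_const))
  have inner : ∀ t, ∫⁻ x, F x * G x t = if 0 < t then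
      ENNReal.ofReal (t ^ ((a + n) / δ + c - 1) * Real.exp (-t)) * J else 0 := by
    intro t
    split_ifs with ht
    -- Substituting `t ^ (1 / δ) • x` for `x` turns `N` into `t * N`. The Jacobian, `F` and the
    -- power contribute the exponents `n / δ`, `a / δ` and `c - 1`.
    · have hr : 0 < t ^ (1 / δ) := by positivity
      have hrd : (t ^ (1 / δ)) ^ δ = t := by
        rw [← Real.rpow_mul ht.le, one_div_mul_cancel hδ.ne', Real.rpow_one]
      rw [lintegral_eq_lintegral_smul hr (hFG t),
        hJ, ← lintegral_const_mul' _ _ ENNReal.ofReal_ne_top,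
        ← lintegral_const_mul' _ _ ENNReal.ofReal_ne_top]
      refine lintegral_congr fun x => ?_
      simp only [hG, hFh _ hr, hNh _ hr, hrd]
      simp only [mul_lt_iff_lt_one_right ht]
      split_ifs with h
      · rw [mul_comm (ENNReal.ofReal _) (F x), mul_left_comm, mul_left_comm (ENNReal.ofReal _) (F x),
          mul_assoc, ← ENNReal.ofReal_mul (by positivity), ← ENNReal.ofReal_mul (by positivity),
          ← ENNReal.ofReal_mul (by positivity)]
        congr 2
        have h1 : 0 ≤ 1 - N x := by linarith
        rw [show t - t * N x = t * (1 - N x) by ring, Real.mul_rpow ht.le h1,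
          ← Real.rpow_natCast, ← Real.rpow_mul ht.le, ← Real.rpow_mul ht.le,
          show (a + n) / δ + c - 1 = 1 / δ * n + 1 / δ * a + (c - 1) by ring,
          Real.rpow_add ht, Real.rpow_add ht]
        ring
      · simp
    · rw [lintegral_eq_zero_iff (hFG t)]
      refine Filter.Eventually.of_forall fun x => ?_
      have := hN0 x
      have h2 : ¬ N x < t := by linarith
      simp [hG, h2]
  calc ENNReal.ofReal (Real.Gamma c) * ∫⁻ x, F x * ENNReal.ofReal (Real.exp (-N x))
      = ∫⁻ x, ∫⁻ t, F x * G x t := by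
        rw [← lintegral_const_mul' _ _ ENNReal.ofReal_ne_top]
        refine lintegral_congr fun x => ?_
        rw [lintegral_const_mul _ (hGx x),
          show ∫⁻ t, G x t = _ from lintegral_gamma_shift hc (N x)]
        ring
    _ = ∫⁻ t, ∫⁻ x, F x * G x t := by
        refine lintegral_lintegral_swap ?_
        exact ((hF.comp measurable_fst).mul hGm).aemeasurable
    _ = _ := by
        simp only [inner]
        rw [← lintegral_gamma hac, ← lintegral_mul_const,
          ← lintegral_indicator measurableSet_Ioi]
        · refine lintegral_congr fun t => ?_
          simp [Set.indicator_apply]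
        · fun_prop

/-- The value of the Dirichlet integrals on the simplex and on the ball. -/
def dirichletValue {n : ℕ} (b : Fin n → ℕ) (c : ℝ) : ℝ :=
  Real.Gamma c * (∏ i, Real.Gamma (b i + 1 / 2)) / Real.Gamma (∑ i, (b i : ℝ) + n / 2 + c)

theorem dirichletValue_pos {n : ℕ} (b : Fin n → ℕ) {c : ℝ} (hc : 0 < c) :
    0 < dirichletValue b c := by
  have h1 := Real.Gamma_pos_of_pos hc
  have h2 : 0 < ∏ i, Real.Gamma (b i + 1 / 2) :=
    Finset.prod_pos fun i _ => Real.Gamma_pos_of_pos (by positivity)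
  have h3 : 0 < Real.Gamma (∑ i, (b i : ℝ) + n / 2 + c) := Real.Gamma_pos_of_pos (by positivity)
  unfold dirichletValue
  positivity

theorem eq_ofReal_dirichletValue {n : ℕ} (b : Fin n → ℕ) {c : ℝ} (hc : 0 < c) {J : ENNReal}
    {A : ℝ} (hA : A = ∑ i, (b i : ℝ) + n / 2)
    (h : ENNReal.ofReal (Real.Gamma c) * ∏ i, ENNReal.ofReal (Real.Gamma (b i + 1 / 2)) =
      ENNReal.ofReal (Real.Gamma (A + c)) * J) : J = ENNReal.ofReal (dirichletValue b c) := by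
  have h1 := Real.Gamma_pos_of_pos hc
  have h3 : 0 < Real.Gamma (A + c) := Real.Gamma_pos_of_pos (by rw [hA]; positivity)
  rw [← ENNReal.ofReal_prod_of_nonneg (fun i _ => (Real.Gamma_pos_of_pos (by positivity)).le),
    ← ENNReal.ofReal_mul h1.le] at h
  rw [dirichletValue, ← hA, ENNReal.ofReal_div_of_pos h3, h, mul_comm, ENNReal.mul_div_cancel_right]
  · simpa using h3
  · exact ENNReal.ofReal_ne_top

theorem lintegral_pow_mul_exp_neg_sq (b : ℕ) :
    ∫⁻ t : ℝ, ENNReal.ofReal (t ^ (2 * b)) * ENNReal.ofReal (Real.exp (-t ^ 2)) =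
      ENNReal.ofReal (Real.Gamma (b + 1 / 2)) := by
  have hi : Integrable fun t : ℝ => t ^ (2 * b) * Real.exp (-t ^ 2) := by
    have := integrable_rpow_mul_exp_neg_mul_sq (b := 1) (s := ((2 * b : ℕ) : ℝ)) one_pos
      (by have : (0 : ℝ) ≤ ((2 * b : ℕ) : ℝ) := by positivity
          linarith)
    simpa only [Real.rpow_natCast, neg_mul, one_mul] using this
  have hnn : ∀ t : ℝ, 0 ≤ t ^ (2 * b) := fun t => by rw [pow_mul]; positivity
  simp only [← ENNReal.ofReal_mul (hnn _)]
  rw [← ofReal_integral_eq_lintegral_ofReal hi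
    (Filter.Eventually.of_forall fun t => mul_nonneg (hnn t) (Real.exp_pos _).le)]
  congr 1
  have e1 : ∫ t : ℝ, t ^ (2 * b) * Real.exp (-t ^ 2) =
      ∫ t : ℝ, (fun s : ℝ => s ^ (2 * b) * Real.exp (-s ^ 2)) |t| := by
    refine integral_congr_ae (Filter.Eventually.of_forall fun t => ?_)
    simp only [pow_mul, sq_abs]
  rw [e1, integral_comp_abs (f := fun s : ℝ => s ^ (2 * b) * Real.exp (-s ^ 2))]
  have e2 := integral_rpow_mul_exp_neg_rpow (p := 2) (q := ((2 * b : ℕ) : ℝ)) two_pos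
      (by have : (0 : ℝ) ≤ ((2 * b : ℕ) : ℝ) := by positivity
          linarith)
  simp only [Real.rpow_natCast, Real.rpow_two] at e2
  rw [e2]
  push_cast
  rw [show (2 * (b : ℝ) + 1) / 2 = b + 1 / 2 by ring]
  ring

/-- `lintegral_homogeneous` with `N = ‖x‖²`, `δ = 2`; the exponential integral is a product of
Gaussian moments. -/
theorem lintegral_ball_moment {n : ℕ} (b : Fin n → ℕ) {c : ℝ} (hc : 0 < c) :
    ∫⁻ x : Fin n → ℝ, (∏ i, ENNReal.ofReal (x i ^ (2 * b i))) *
        (if ∑ i, x i ^ 2 < 1 then ENNReal.ofReal ((1 - ∑ i, x i ^ 2) ^ (c - 1)) else 0) =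
      ENNReal.ofReal (dirichletValue b c) := by
  have hA : ((∑ i, (2 * b i : ℝ)) + n) / 2 = ∑ i, (b i : ℝ) + n / 2 := by
    rw [← Finset.mul_sum]; ring
  refine eq_ofReal_dirichletValue b hc hA ?_
  rw [← lintegral_homogeneous (F := fun x => ∏ i, ENNReal.ofReal (x i ^ (2 * b i)))
    (N := fun x => ∑ i, x i ^ 2) (by fun_prop) (by fun_prop) (fun x => by positivity) two_pos hc
    (by positivity)]
  · congr 1
    simp only [← lintegral_pow_mul_exp_neg_sq]
    rw [← lintegral_pi_prod_eq (fun i t => ENNReal.ofReal (t ^ (2 * b i)) *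
      ENNReal.ofReal (Real.exp (-t ^ 2))) (fun i => by fun_prop)]
    refine lintegral_congr fun x => ?_
    rw [Finset.prod_mul_distrib, ← Finset.sum_neg_distrib, Real.exp_sum,
      ENNReal.ofReal_prod_of_nonneg fun i _ => (Real.exp_pos _).le]
  · intro r hr x
    rw [Real.rpow_sum_of_pos hr, ENNReal.ofReal_prod_of_nonneg (fun i _ => by positivity),
      ← Finset.prod_mul_distrib]
    refine Finset.prod_congr rfl fun i _ => ?_
    rw [← ENNReal.ofReal_mul (by positivity), Pi.smul_apply, smul_eq_mul, mul_pow]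
    congr 2
    exact_mod_cast (Real.rpow_natCast r (2 * b i)).symm
  · intro r hr x
    simp [mul_pow, Finset.mul_sum]

/-- `lintegral_homogeneous` with `δ = 1`. Absolute values keep `N` nonnegative on all of `ℝⁿ`, while
`F` vanishes off the open positive orthant. The value agrees with the ball integral with exponents
doubled, which is what later links the two measures. -/
theorem lintegral_simplex_moment {n : ℕ} (b : Fin n → ℕ) {c : ℝ} (hc : 0 < c) :
    ∫⁻ x : Fin n → ℝ, (∏ i, if 0 < x i then ENNReal.ofReal (x i ^ ((b i : ℝ) - 1 / 2)) else 0) *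
        (if ∑ i, |x i| < 1 then ENNReal.ofReal ((1 - ∑ i, |x i|) ^ (c - 1)) else 0) =
      ENNReal.ofReal (dirichletValue b c) := by
  have hA : ((∑ i, ((b i : ℝ) - 1 / 2)) + n) / 1 = ∑ i, (b i : ℝ) + n / 2 := by
    simp only [Finset.sum_sub_distrib, Finset.sum_const, Finset.card_univ, Fintype.card_fin,
      nsmul_eq_mul]
    ring
  have hm : ∀ i, Measurable fun t : ℝ =>
      if 0 < t then ENNReal.ofReal (t ^ ((b i : ℝ) - 1 / 2)) else 0 := fun i =>
    Measurable.ite measurableSet_Ioi (by fun_prop) measurable_const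
  refine eq_ofReal_dirichletValue b hc hA ?_
  rw [← lintegral_homogeneous
    (F := fun x => ∏ i, if 0 < x i then ENNReal.ofReal (x i ^ ((b i : ℝ) - 1 / 2)) else 0)
    (N := fun x => ∑ i, |x i|)
    (Finset.measurable_prod _ fun i _ => (hm i).comp (measurable_pi_apply i))
    (Finset.measurable_sum _ fun i _ => (measurable_pi_apply i).abs)
    (fun x => by positivity) one_pos hc (by rw [hA]; positivity)]
  · congr 1
    rw [← Finset.prod_congr rfl fun i _ =>
      lintegral_gamma (c := (b i : ℝ) + 1 / 2) (by positivity)]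
    simp only [← lintegral_indicator measurableSet_Ioi]
    rw [← lintegral_pi_prod_eq _ fun i => (by
      refine Measurable.indicator ?_ measurableSet_Ioi
      fun_prop)]
    refine lintegral_congr fun x => ?_
    rw [← Finset.sum_neg_distrib, Real.exp_sum,
      ENNReal.ofReal_prod_of_nonneg fun i _ => (Real.exp_pos _).le, ← Finset.prod_mul_distrib]
    refine Finset.prod_congr rfl fun i _ => ?_
    rw [Set.indicator_apply]
    simp only [Set.mem_Ioi]
    split_ifs with h
    · rw [← ENNReal.ofReal_mul (by positivity), abs_of_pos h,
        show (b i : ℝ) + 1 / 2 - 1 = b i - 1 / 2 by ring]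
    · simp
  · intro r hr x
    rw [Real.rpow_sum_of_pos hr, ENNReal.ofReal_prod_of_nonneg (fun i _ => by positivity),
      ← Finset.prod_mul_distrib]
    refine Finset.prod_congr rfl fun i _ => ?_
    simp only [Pi.smul_apply, smul_eq_mul, mul_pos_iff_of_pos_left hr]
    split_ifs with h
    · rw [← ENNReal.ofReal_mul (by positivity), Real.mul_rpow hr.le h.le]
    · simp
  · intro r hr x
    simp [abs_mul, abs_of_pos hr, Finset.mul_sum]

end

/-! ### The two probability measures and their moments. -/

noncomputable section

theorem lintegral_weightedProb {n : ℕ} {X : Set (Fin n → ℝ)} {w : (Fin n → ℝ) → ℝ}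
    (hw : Measurable w) {h : (Fin n → ℝ) → ENNReal} (hh : Measurable h) :
    ∫⁻ x, h x ∂(weightedProb X w) =
      (∫⁻ x in X, ENNReal.ofReal (w x))⁻¹ * ∫⁻ x in X, ENNReal.ofReal (w x) * h x := by
  rw [weightedProb, lintegral_smul_measure, smul_eq_mul,
    lintegral_withDensity_eq_lintegral_mul _ (by fun_prop) hh]
  rfl

/-- A probability measure on a compact set for which the polynomials form an inner product
space. -/
structure IsPolyMeasure {n : ℕ} (X : Set (Fin n → ℝ)) (μ : Measure (Fin n → ℝ)) : Prop where
  isCompact : IsCompact X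
  isProbabilityMeasure : IsProbabilityMeasure μ
  ae_mem : ∀ᵐ x ∂μ, x ∈ X
  definite : ∀ p : MvPolynomial (Fin n) ℝ,
    ∫ x, MvPolynomial.eval x p * MvPolynomial.eval x p ∂μ = 0 → p = 0

theorem integrable_of_continuous_of_ae_mem {n : ℕ} {X : Set (Fin n → ℝ)} {μ : Measure (Fin n → ℝ)}
    [IsFiniteMeasure μ] (hX : IsCompact X) (hμ : ∀ᵐ x ∂μ, x ∈ X) {f : (Fin n → ℝ) → ℝ}
    (hf : Continuous f) : Integrable f μ := by
  obtain ⟨C, hC⟩ := hX.exists_bound_of_continuousOn hf.continuousOn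
  exact Integrable.of_bound hf.aestronglyMeasurable C (hμ.mono hC)

theorem weightedProb_ae_mem {n : ℕ} {X : Set (Fin n → ℝ)} (hX : MeasurableSet X)
    {w : (Fin n → ℝ) → ℝ} : ∀ᵐ x ∂(weightedProb X w), x ∈ X := by
  refine Measure.ae_smul_measure ?_ _
  exact (withDensity_absolutelyContinuous _ _).ae_le (ae_restrict_mem hX)

/-- For definiteness: if `∫ p² = 0`, then `p` vanishes almost everywhere, hence by continuity
everywhere, on a small open cube where the weight is positive. A polynomial vanishing on a product
of infinite sets is zero. -/
theorem isPolyMeasure_weightedProb {n : ℕ} {X : Set (Fin n → ℝ)} {w : (Fin n → ℝ) → ℝ}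
    (hX : IsCompact X) (hw : Measurable w) (hZ0 : ∫⁻ x in X, ENNReal.ofReal (w x) ≠ 0)
    (hZ : ∫⁻ x in X, ENNReal.ofReal (w x) ≠ ⊤) {ε : ℝ} (hε : 0 < ε)
    (hU : ∀ x : Fin n → ℝ, (∀ i, x i ∈ Set.Ioo 0 ε) → x ∈ X ∧ 0 < w x) :
    IsPolyMeasure X (weightedProb X w) := by
  have hprob : IsProbabilityMeasure (weightedProb X w) := by
    constructor
    rw [← lintegral_one, lintegral_weightedProb hw measurable_const]
    simp only [mul_one]
    exact ENNReal.inv_mul_cancel hZ0 hZ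
  have hmem := weightedProb_ae_mem hX.measurableSet (w := w)
  refine ⟨hX, hprob, hmem, fun p hp => ?_⟩
  have hc : Continuous fun x => MvPolynomial.eval x p := MvPolynomial.continuous_eval p
  rw [integral_eq_zero_iff_of_nonneg (fun x => mul_self_nonneg _)
    (integrable_of_continuous_of_ae_mem hX hmem (hc.mul hc))] at hp
  have hp2 : ∀ᵐ x ∂(volume.restrict X).withDensity (fun x => ENNReal.ofReal (w x)),
      MvPolynomial.eval x p * MvPolynomial.eval x p = 0 := by
    rw [weightedProb, Filter.EventuallyEq, Measure.ae_ennreal_smul_measure_iff] at hp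
    · exact hp
    · simpa using hZ
  rw [ae_withDensity_iff (by fun_prop)] at hp2
  set U : Set (Fin n → ℝ) := Set.univ.pi fun _ => Set.Ioo 0 ε
  have hUo : IsOpen U := isOpen_set_pi Set.finite_univ fun _ _ => isOpen_Ioo
  have hUX : ∀ x ∈ U, x ∈ X ∧ 0 < w x := fun x hx => hU x fun i => hx i trivial
  have hp3 : (fun x => MvPolynomial.eval x p) =ᵐ[volume.restrict U] fun _ => (0 : ℝ) := by
    have h1 := ae_restrict_of_ae_restrict_of_subset (fun x hx => (hUX x hx).1) hp2
    filter_upwards [h1, ae_restrict_mem hUo.measurableSet] with x hx hxU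
    have := hx (by simpa using (hUX x hxU).2)
    simpa using this
  have h4 := Measure.eqOn_open_of_ae_eq hp3 hUo hc.continuousOn continuousOn_const
  refine MvPolynomial.funext_set (fun _ => Set.Ioo 0 ε) (fun _ => Set.Ioo_infinite hε) ?_
  intro x hx
  exact (h4 hx).trans (map_zero _).symm

/-- The density of `ballMeasure`, up to normalization. -/
def ballWeight {n : ℕ} (x : Fin n → ℝ) : ℝ := (1 - ∑ i, x i ^ 2) ^ (-(1 / 2) : ℝ)

/-- The density of `simplexMeasure`, up to normalization. -/
def simplexWeight {n : ℕ} (x : Fin n → ℝ) : ℝ :=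
  (∏ i, x i ^ (-(1 / 2) : ℝ)) * (1 - ∑ i, x i) ^ (-(1 / 2) : ℝ)

theorem measurable_ballWeight {n : ℕ} : Measurable (ballWeight (n := n)) := by
  unfold ballWeight
  fun_prop

theorem measurable_simplexWeight {n : ℕ} : Measurable (simplexWeight (n := n)) := by
  unfold simplexWeight
  fun_prop

theorem isCompact_unitBall (n : ℕ) : IsCompact (unitBall n) := by
  refine Metric.isCompact_of_isClosed_isBounded ?_ ?_
  · exact isClosed_le (by fun_prop) continuous_const
  · refine (Metric.isBounded_closedBall (x := (0 : Fin n → ℝ)) (r := 1)).subset fun x hx => ?_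
    rw [mem_closedBall_zero_iff, pi_norm_le_iff_of_nonneg zero_le_one]
    intro i
    have h1 : x i ^ 2 ≤ 1 :=
      (Finset.single_le_sum (f := fun i => x i ^ 2) (fun i _ => sq_nonneg _)
        (Finset.mem_univ i)).trans hx
    rw [Real.norm_eq_abs]
    exact (sq_le_one_iff_abs_le_one _).1 h1

theorem isCompact_solidSimplex (n : ℕ) : IsCompact (solidSimplex n) := by
  refine Metric.isCompact_of_isClosed_isBounded ?_ ?_
  · have h1 : IsClosed (⋂ i, {x : Fin n → ℝ | 0 ≤ x i}) :=
      isClosed_iInter fun i => isClosed_le continuous_const (continuous_apply i)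
    have h2 : IsClosed {x : Fin n → ℝ | 0 ≤ 1 - ∑ i, x i} :=
      isClosed_le continuous_const (by fun_prop)
    have h3 : solidSimplex n = (⋂ i, {x : Fin n → ℝ | 0 ≤ x i}) ∩ {x | 0 ≤ 1 - ∑ i, x i} := by
      ext x
      simp [solidSimplex]
    rw [h3]
    exact h1.inter h2
  · refine (Metric.isBounded_closedBall (x := (0 : Fin n → ℝ)) (r := 1)).subset fun x hx => ?_
    rw [mem_closedBall_zero_iff, pi_norm_le_iff_of_nonneg zero_le_one]
    intro i
    have h1 : x i ≤ ∑ i, x i := Finset.single_le_sum (fun i _ => hx.1 i) (Finset.mem_univ i)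
    rw [Real.norm_eq_abs, abs_of_nonneg (hx.1 i)]
    linarith [hx.2]

theorem lintegral_ballWeight_mul {n : ℕ} (b : Fin n → ℕ) (j : ℕ) :
    ∫⁻ x in unitBall n, ENNReal.ofReal (ballWeight x) *
        ENNReal.ofReal ((∏ i, x i ^ (2 * b i)) * (1 - ∑ i, x i ^ 2) ^ j) =
      ENNReal.ofReal (dirichletValue b (j + 1 / 2)) := by
  rw [← lintegral_ball_moment b (by positivity : (0 : ℝ) < j + 1 / 2),
    ← lintegral_indicator (isCompact_unitBall n).measurableSet]
  refine lintegral_congr fun x => ?_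
  have hP : 0 ≤ ∏ i, x i ^ (2 * b i) :=
    Finset.prod_nonneg fun i _ => by rw [pow_mul]; positivity
  rw [← ENNReal.ofReal_prod_of_nonneg fun i _ => by rw [pow_mul]; positivity]
  rcases lt_trichotomy (∑ i, x i ^ 2) 1 with h | h | h
  · rw [Set.indicator_of_mem (show x ∈ unitBall n from h.le), if_pos h, ballWeight]
    have h1 : 0 < 1 - ∑ i, x i ^ 2 := by linarith
    rw [← ENNReal.ofReal_mul (by positivity), ← ENNReal.ofReal_mul hP,
      show (j : ℝ) + 1 / 2 - 1 = -(1 / 2) + j by ring, Real.rpow_add h1, Real.rpow_natCast]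
    congr 1
    ring
  -- On the boundary sphere the real power `0 ^ (-(1/2))` is `0` by convention, matching the strict
  -- inequality on the other side.
  · rw [Set.indicator_of_mem (show x ∈ unitBall n from h.le), if_neg h.not_lt, ballWeight, h,
      sub_self, Real.zero_rpow (by norm_num)]
    simp
  · rw [Set.indicator_of_notMem (show x ∉ unitBall n from not_le.2 h), if_neg h.not_gt, mul_zero]

theorem lintegral_simplexWeight_mul {n : ℕ} (b : Fin n → ℕ) :
    ∫⁻ x in solidSimplex n, ENNReal.ofReal (simplexWeight x) *
        ENNReal.ofReal (∏ i, x i ^ b i) = ENNReal.ofReal (dirichletValue b (1 / 2)) := by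
  rw [← lintegral_simplex_moment b (by positivity : (0 : ℝ) < 1 / 2),
    ← lintegral_indicator (isCompact_solidSimplex n).measurableSet]
  refine lintegral_congr fun x => ?_
  by_cases h0 : ∀ i, 0 < x i
  · have habs : ∑ i, |x i| = ∑ i, x i := Finset.sum_congr rfl fun i _ => abs_of_pos (h0 i)
    have hif : (∏ i, if 0 < x i then ENNReal.ofReal (x i ^ ((b i : ℝ) - 1 / 2)) else 0) =
        ENNReal.ofReal (∏ i, x i ^ ((b i : ℝ) - 1 / 2)) := by
      rw [ENNReal.ofReal_prod_of_nonneg fun i _ => by have := h0 i; positivity]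
      exact Finset.prod_congr rfl fun i _ => if_pos (h0 i)
    have hpr : ∏ i, x i ^ ((b i : ℝ) - 1 / 2) =
        (∏ i, x i ^ (-(1 / 2) : ℝ)) * ∏ i, x i ^ b i := by
      rw [← Finset.prod_mul_distrib]
      refine Finset.prod_congr rfl fun i _ => ?_
      rw [← Real.rpow_natCast, ← Real.rpow_add (h0 i)]
      congr 1
      ring
    have hP1 : 0 ≤ ∏ i, x i ^ (-(1 / 2) : ℝ) :=
      Finset.prod_nonneg fun i _ => by have := h0 i; positivity
    have hP2 : 0 ≤ ∏ i, x i ^ b i := Finset.prod_nonneg fun i _ => by have := h0 i; positivity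
    rw [habs, hif, hpr]
    rcases lt_trichotomy (∑ i, x i) 1 with h | h | h
    · have h1 : 0 < 1 - ∑ i, x i := by linarith
      rw [Set.indicator_of_mem (show x ∈ solidSimplex n from ⟨fun i => (h0 i).le, h1.le⟩),
        if_pos h, simplexWeight, ← ENNReal.ofReal_mul (by positivity),
        ← ENNReal.ofReal_mul (by positivity), show (1 : ℝ) / 2 - 1 = -(1 / 2) by norm_num]
      congr 1
      ring
    · rw [Set.indicator_of_mem (show x ∈ solidSimplex n from ⟨fun i => (h0 i).le, by simp [h]⟩),
        if_neg h.not_lt, simplexWeight, h, sub_self, Real.zero_rpow (by norm_num)]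
      simp
    · rw [Set.indicator_of_notMem (show x ∉ solidSimplex n from fun hx => by linarith [hx.2]),
        if_neg h.not_gt, mul_zero]
  · push Not at h0
    obtain ⟨i, hi⟩ := h0
    have hz : (∏ i, if 0 < x i then ENNReal.ofReal (x i ^ ((b i : ℝ) - 1 / 2)) else 0) = 0 :=
      Finset.prod_eq_zero (Finset.mem_univ i) (if_neg hi.not_gt)
    rw [hz, zero_mul]
    by_cases hx : x ∈ solidSimplex n
    -- On a coordinate face the same convention `0 ^ (-(1/2)) = 0` makes the weight vanish.
    · have hxi : x i = 0 := le_antisymm hi (hx.1 i)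
      have hw : simplexWeight x = 0 := by
        rw [simplexWeight, Finset.prod_eq_zero (Finset.mem_univ i), zero_mul]
        rw [hxi, Real.zero_rpow (by norm_num)]
      rw [Set.indicator_of_mem hx, hw]
      simp
    · rw [Set.indicator_of_notMem hx]

theorem lintegral_ballWeight (n : ℕ) : ∫⁻ x in unitBall n, ENNReal.ofReal (ballWeight x) =
    ENNReal.ofReal (dirichletValue (fun _ : Fin n => 0) (1 / 2)) := by
  simpa using lintegral_ballWeight_mul (fun _ : Fin n => 0) 0

theorem lintegral_simplexWeight (n : ℕ) :
    ∫⁻ x in solidSimplex n, ENNReal.ofReal (simplexWeight x) =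
      ENNReal.ofReal (dirichletValue (fun _ : Fin n => 0) (1 / 2)) := by
  simpa using lintegral_simplexWeight_mul (fun _ : Fin n => 0)

theorem sum_lt_one_of_lt {n : ℕ} {x : Fin n → ℝ} (h : ∀ i, x i ∈ Set.Ioo (0 : ℝ) (1 / (n + 1))) :
    ∑ i, x i < 1 := by
  have h1 : ∑ i, x i ≤ ∑ _i : Fin n, (1 / ((n : ℝ) + 1)) :=
    Finset.sum_le_sum fun i _ => (h i).2.le
  rw [Finset.sum_const, Finset.card_univ, Fintype.card_fin, nsmul_eq_mul] at h1
  refine h1.trans_lt ?_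
  rw [mul_one_div, div_lt_one (by positivity)]
  linarith

theorem isPolyMeasure_ball (n : ℕ) : IsPolyMeasure (unitBall n) (ballMeasure n) := by
  have hpos := dirichletValue_pos (fun _ : Fin n => 0) (c := 1 / 2) (by norm_num)
  refine isPolyMeasure_weightedProb (w := ballWeight) (ε := 1 / (n + 1)) (isCompact_unitBall n)
    measurable_ballWeight ?_ ?_ (by positivity) ?_
  · rw [lintegral_ballWeight]
    simpa using hpos
  · rw [lintegral_ballWeight]
    exact ENNReal.ofReal_ne_top
  · intro x hx
    have h1 : ∑ i, x i ^ 2 ≤ ∑ i, x i := Finset.sum_le_sum fun i _ => by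
      have h2 := (hx i).1
      have h3 : x i < 1 := (hx i).2.trans_le (by
        rw [div_le_one (by positivity)]; linarith [(Nat.cast_nonneg n : (0 : ℝ) ≤ n)])
      nlinarith
    have h2 := sum_lt_one_of_lt hx
    exact ⟨(h1.trans h2.le : _), Real.rpow_pos_of_pos (by linarith) _⟩

theorem isPolyMeasure_simplex (n : ℕ) : IsPolyMeasure (solidSimplex n) (simplexMeasure n) := by
  have hpos := dirichletValue_pos (fun _ : Fin n => 0) (c := 1 / 2) (by norm_num)
  refine isPolyMeasure_weightedProb (w := simplexWeight) (ε := 1 / (n + 1))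
    (isCompact_solidSimplex n) measurable_simplexWeight ?_ ?_ (by positivity) ?_
  · rw [lintegral_simplexWeight]
    simpa using hpos
  · rw [lintegral_simplexWeight]
    exact ENNReal.ofReal_ne_top
  · intro x hx
    have h2 := sum_lt_one_of_lt hx
    exact ⟨⟨fun i => (hx i).1.le, by linarith⟩,
      mul_pos (Finset.prod_pos fun i _ => Real.rpow_pos_of_pos (hx i).1 _)
        (Real.rpow_pos_of_pos (by linarith) _)⟩

theorem integral_ball_even {n : ℕ} (b : Fin n → ℕ) (j : ℕ) :
    ∫ x, (∏ i, x i ^ (2 * b i)) * (1 - ∑ i, x i ^ 2) ^ j ∂(ballMeasure n) =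
      dirichletValue b (j + 1 / 2) / dirichletValue (fun _ : Fin n => 0) (1 / 2) := by
  have h0 := dirichletValue_pos (fun _ : Fin n => 0) (c := 1 / 2) (by norm_num)
  have h1 := dirichletValue_pos b (c := j + 1 / 2) (by positivity)
  rw [integral_eq_lintegral_of_nonneg_ae, ballMeasure,
    lintegral_weightedProb (w := fun x => (1 - ∑ i, x i ^ 2) ^ (-(1 / 2) : ℝ))
      measurable_ballWeight (by fun_prop),
    show ∫⁻ x in unitBall n, ENNReal.ofReal ((1 - ∑ i, x i ^ 2) ^ (-(1 / 2) : ℝ)) = _ from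
      lintegral_ballWeight n,
    show ∫⁻ x in unitBall n, ENNReal.ofReal ((1 - ∑ i, x i ^ 2) ^ (-(1 / 2) : ℝ)) *
      ENNReal.ofReal ((∏ i, x i ^ (2 * b i)) * (1 - ∑ i, x i ^ 2) ^ j) = _ from
      lintegral_ballWeight_mul b j, ENNReal.toReal_mul, ENNReal.toReal_inv,
    ENNReal.toReal_ofReal h0.le, ENNReal.toReal_ofReal h1.le]
  · ring
  · filter_upwards [(isPolyMeasure_ball n).ae_mem] with x hx
    have hx' : 0 ≤ 1 - ∑ i, x i ^ 2 := sub_nonneg.2 hx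
    exact mul_nonneg (Finset.prod_nonneg fun i _ => by rw [pow_mul]; positivity) (by positivity)
  · exact Continuous.aestronglyMeasurable (by fun_prop)

theorem integral_simplex_monomial {n : ℕ} (b : Fin n → ℕ) :
    ∫ x, ∏ i, x i ^ b i ∂(simplexMeasure n) =
      dirichletValue b (1 / 2) / dirichletValue (fun _ : Fin n => 0) (1 / 2) := by
  have h0 := dirichletValue_pos (fun _ : Fin n => 0) (c := 1 / 2) (by norm_num)
  have h1 := dirichletValue_pos b (c := 1 / 2) (by positivity)
  rw [integral_eq_lintegral_of_nonneg_ae, simplexMeasure,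
    lintegral_weightedProb (w := fun x =>
        (∏ i, x i ^ (-(1 / 2) : ℝ)) * (1 - ∑ i, x i) ^ (-(1 / 2) : ℝ))
      measurable_simplexWeight (by fun_prop),
    show ∫⁻ x in solidSimplex n, ENNReal.ofReal
      ((∏ i, x i ^ (-(1 / 2) : ℝ)) * (1 - ∑ i, x i) ^ (-(1 / 2) : ℝ)) = _ from
      lintegral_simplexWeight n,
    show ∫⁻ x in solidSimplex n, ENNReal.ofReal
      ((∏ i, x i ^ (-(1 / 2) : ℝ)) * (1 - ∑ i, x i) ^ (-(1 / 2) : ℝ)) *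
      ENNReal.ofReal (∏ i, x i ^ b i) = _ from
      lintegral_simplexWeight_mul b, ENNReal.toReal_mul, ENNReal.toReal_inv,
    ENNReal.toReal_ofReal h0.le, ENNReal.toReal_ofReal h1.le]
  · ring
  · filter_upwards [(isPolyMeasure_simplex n).ae_mem] with x hx
    exact Finset.prod_nonneg fun i _ => pow_nonneg (hx.1 i) _
  · exact Continuous.aestronglyMeasurable (by fun_prop)

/-- The reflection in the `i`-th coordinate hyperplane. -/
def flipCoord {n : ℕ} (i : Fin n) (x : Fin n → ℝ) : Fin n → ℝ :=
  fun j => if j = i then -x j else x j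

theorem measurePreserving_flipCoord {n : ℕ} (i : Fin n) :
    MeasurePreserving (flipCoord i) volume volume := by
  refine volume_preserving_pi (f := fun j t => if j = i then -t else t) fun j => ?_
  split_ifs
  · exact Measure.measurePreserving_neg volume
  · exact MeasurePreserving.id volume

theorem flipCoord_flipCoord {n : ℕ} (i : Fin n) (x : Fin n → ℝ) :
    flipCoord i (flipCoord i x) = x := by
  ext j
  by_cases h : j = i <;> simp [flipCoord, h]

theorem sum_sq_flipCoord {n : ℕ} (i : Fin n) (x : Fin n → ℝ) :
    ∑ j, flipCoord i x j ^ 2 = ∑ j, x j ^ 2 := by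
  refine Finset.sum_congr rfl fun j _ => ?_
  by_cases h : j = i <;> simp [flipCoord, h]

/-- Reflections preserve Lebesgue measure, the ball and the weight. This is the source of all
vanishing of odd moments. -/
theorem integral_ball_flipCoord {n : ℕ} (i : Fin n) (f : (Fin n → ℝ) → ℝ) :
    ∫ x, f (flipCoord i x) ∂(ballMeasure n) = ∫ x, f x ∂(ballMeasure n) := by
  have hm := (measurePreserving_flipCoord i).measurable
  have hemb : MeasurableEmbedding (flipCoord i) :=
    (MeasurableEquiv.mk ⟨flipCoord i, flipCoord i, flipCoord_flipCoord i, flipCoord_flipCoord i⟩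
      hm hm).measurableEmbedding
  have key : ∀ g : (Fin n → ℝ) → ℝ, ∫ x, g x ∂(ballMeasure n) =
      ((∫⁻ x in unitBall n, ENNReal.ofReal (ballWeight x))⁻¹).toReal •
        ∫ x in unitBall n, (ENNReal.ofReal (ballWeight x)).toReal • g x := by
    intro g
    rw [show ballMeasure n = weightedProb (unitBall n) ballWeight from rfl, weightedProb,
      integral_smul_measure,
      integral_withDensity_eq_integral_toReal_smul (measurable_ballWeight.ennreal_ofReal)
        (Filter.Eventually.of_forall fun _ => ENNReal.ofReal_lt_top)]
  rw [key, key, ← (measurePreserving_flipCoord i).setIntegral_preimage_emb hemb _ (unitBall n)]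
  have hpre : flipCoord i ⁻¹' unitBall n = unitBall n := by
    ext x
    simp only [unitBall, Set.mem_preimage, Set.mem_ofPred_eq, sum_sq_flipCoord]
  simp only [hpre, ballWeight, sum_sq_flipCoord, flipCoord_flipCoord]

theorem prod_pow_flipCoord_of_odd {n : ℕ} {b : Fin n → ℕ} {i : Fin n} (hi : Odd (b i))
    (x : Fin n → ℝ) : ∏ k, flipCoord i x k ^ b k = -∏ k, x k ^ b k := by
  rw [← Finset.mul_prod_erase _ _ (Finset.mem_univ i),
    ← Finset.mul_prod_erase _ (fun k => x k ^ b k) (Finset.mem_univ i), ← neg_mul]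
  congr 1
  · simp [flipCoord, hi.neg_pow]
  · refine Finset.prod_congr rfl fun k hk => ?_
    simp [flipCoord, Finset.ne_of_mem_erase hk]

theorem integral_ball_odd {n : ℕ} (b : Fin n → ℕ) (j : ℕ) {i : Fin n} (hi : Odd (b i)) :
    ∫ x, (∏ i, x i ^ b i) * (1 - ∑ i, x i ^ 2) ^ j ∂(ballMeasure n) = 0 := by
  have h := integral_ball_flipCoord i fun x => (∏ i, x i ^ b i) * (1 - ∑ i, x i ^ 2) ^ j
  simp only [prod_pow_flipCoord_of_odd hi, sum_sq_flipCoord, neg_mul, integral_neg] at h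
  linarith

end

/-! ### Orthogonal decompositions and harmonic constants for a general measure. -/

noncomputable section

namespace IsPolyMeasure

variable {n : ℕ} {X : Set (Fin n → ℝ)} {μ : Measure (Fin n → ℝ)}

theorem integrable (hμ : IsPolyMeasure X μ) {f : (Fin n → ℝ) → ℝ} (hf : Continuous f) :
    Integrable f μ :=
  have := hμ.isProbabilityMeasure
  integrable_of_continuous_of_ae_mem hμ.isCompact hμ.ae_mem hf

/-- The inner product of polynomials in `L²(μ)`. -/
def form (hμ : IsPolyMeasure X μ) : LinearMap.BilinForm ℝ (MvPolynomial (Fin n) ℝ) :=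
  LinearMap.mk₂ ℝ (fun p q => ∫ x, MvPolynomial.eval x p * MvPolynomial.eval x q ∂μ)
    (fun p p' q => by
      simp only [map_add, add_mul]
      exact integral_add
        (hμ.integrable ((MvPolynomial.continuous_eval p).mul (MvPolynomial.continuous_eval q)))
        (hμ.integrable ((MvPolynomial.continuous_eval p').mul (MvPolynomial.continuous_eval q))))
    (fun a p q => by
      simp only [MvPolynomial.smul_eval, mul_assoc, integral_const_mul, smul_eq_mul])
    (fun p q q' => by
      simp only [map_add, mul_add]
      exact integral_add
        (hμ.integrable ((MvPolynomial.continuous_eval p).mul (MvPolynomial.continuous_eval q)))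
        (hμ.integrable ((MvPolynomial.continuous_eval p).mul (MvPolynomial.continuous_eval q'))))
    (fun a p q => by
      simp only [MvPolynomial.smul_eval, mul_left_comm _ a, integral_const_mul, smul_eq_mul])

theorem form_apply (hμ : IsPolyMeasure X μ) (p q : MvPolynomial (Fin n) ℝ) :
    hμ.form p q = ∫ x, MvPolynomial.eval x p * MvPolynomial.eval x q ∂μ := rfl

theorem form_comm (hμ : IsPolyMeasure X μ) (p q : MvPolynomial (Fin n) ℝ) :
    hμ.form p q = hμ.form q p := by
  simp only [form_apply, mul_comm]

theorem form_self_nonneg (hμ : IsPolyMeasure X μ) (p : MvPolynomial (Fin n) ℝ) :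
    0 ≤ hμ.form p p := integral_nonneg fun _ => mul_self_nonneg _

theorem eq_of_eqOn (hμ : IsPolyMeasure X μ) {p q : MvPolynomial (Fin n) ℝ}
    (h : ∀ x ∈ X, MvPolynomial.eval x p = MvPolynomial.eval x q) : p = q := by
  rw [← sub_eq_zero]
  refine hμ.definite _ ?_
  rw [integral_eq_zero_of_ae]
  filter_upwards [hμ.ae_mem] with x hx
  simp [h x hx]

theorem nonempty (hμ : IsPolyMeasure X μ) : X.Nonempty := by
  have := hμ.isProbabilityMeasure
  exact hμ.ae_mem.exists.imp fun _ h => h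

theorem form_eq_zero_of_lt (hμ : IsPolyMeasure X μ) {i j : ℕ} (hij : i ≠ j)
    {p q : MvPolynomial (Fin n) ℝ} (hp : p ∈ orthSpace μ i) (hq : q ∈ orthSpace μ j) :
    hμ.form p q = 0 := by
  rcases lt_or_gt_of_ne hij with h | h
  · rw [form_comm]
    exact hq.2 p (hp.1.trans_lt h)
  · exact hp.2 q (hq.1.trans_lt h)

/-- Orthogonal projection onto polynomials of degree at most `d`: on this finite-dimensional space
the form is definite, so the map to the dual is injective, hence surjective. -/
theorem exists_orthogonal_sub (hμ : IsPolyMeasure X μ) (d : ℕ) (p : MvPolynomial (Fin n) ℝ) :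
    ∃ q : MvPolynomial (Fin n) ℝ, q.totalDegree ≤ d ∧
      ∀ f : MvPolynomial (Fin n) ℝ, f.totalDegree ≤ d → hμ.form (p - q) f = 0 := by
  set W := MvPolynomial.restrictTotalDegree (Fin n) ℝ d
  set T : W →ₗ[ℝ] Module.Dual ℝ W := hμ.form.domRestrict₁₂ W W
  have hinj : Function.Injective T := by
    rw [← LinearMap.ker_eq_bot, LinearMap.ker_eq_bot']
    intro q hq
    have h1 : hμ.form q q = 0 := LinearMap.congr_fun hq q
    exact Subtype.ext (hμ.definite _ h1)
  obtain ⟨q, hq⟩ := (LinearMap.injective_iff_surjective_of_finrank_eq_finrank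
    Subspace.dual_finrank_eq.symm).1 hinj ((hμ.form p).domRestrict W)
  refine ⟨q, (MvPolynomial.mem_restrictTotalDegree _ _ _).1 q.2, fun f hf => ?_⟩
  have h1 : hμ.form q f = hμ.form p f :=
    LinearMap.congr_fun hq ⟨f, (MvPolynomial.mem_restrictTotalDegree _ _ _).2 hf⟩
  rw [map_sub, LinearMap.sub_apply, h1, sub_self]

theorem exists_decomp (hμ : IsPolyMeasure X μ) (d : ℕ) :
    ∀ p : MvPolynomial (Fin n) ℝ, p.totalDegree ≤ d →
      ∃ c : Fin (d + 1) → MvPolynomial (Fin n) ℝ,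
        (∀ k : Fin (d + 1), c k ∈ orthSpace μ k) ∧ p = ∑ k, c k := by
  induction d with
  | zero =>
    intro p hp
    -- For `k = 0` orthogonality is vacuous, as no `totalDegree` is below `0`.
    exact ⟨fun _ => p, fun k => ⟨hp.trans (Nat.zero_le _), fun q hq => by
      have := k.isLt; omega⟩, by simp⟩
  | succ d ih =>
    intro p hp
    obtain ⟨q, hq, h⟩ := hμ.exists_orthogonal_sub d p
    obtain ⟨c, hc, hsum⟩ := ih q hq
    refine ⟨Fin.snoc c (p - q), fun k => ?_, ?_⟩
    · refine Fin.lastCases ?_ (fun k => ?_) k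
      · rw [Fin.snoc_last]
        refine ⟨(MvPolynomial.totalDegree_sub _ _).trans (max_le hp ?_), fun f hf => ?_⟩
        · simp only [Fin.val_last]; omega
        · simp only [Fin.val_last] at hf
          exact h f (by omega)
      · rw [Fin.snoc_castSucc]
        exact hc k
    · rw [Fin.sum_univ_castSucc]
      simp [← hsum]

/-- Pairing with `f ∈ H_j` isolates the `j`-th component of a sum. So `c j - c' j` is orthogonal to
all of `H_j`, in particular to `c j` and `c' j`, and hence to itself. -/
theorem decomp_unique (hμ : IsPolyMeasure X μ) {d : ℕ}
    {c c' : Fin (d + 1) → MvPolynomial (Fin n) ℝ} (hc : ∀ k : Fin (d + 1), c k ∈ orthSpace μ k)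
    (hc' : ∀ k : Fin (d + 1), c' k ∈ orthSpace μ k) (h : ∑ k, c k = ∑ k, c' k) : c = c' := by
  funext j
  rw [← sub_eq_zero]
  refine hμ.definite _ ?_
  have key : ∀ b : Fin (d + 1) → MvPolynomial (Fin n) ℝ, (∀ k : Fin (d + 1), b k ∈ orthSpace μ k) →
      ∀ f ∈ orthSpace μ j, hμ.form f (b j) = hμ.form f (∑ k, b k) := by
    intro b hb f hf
    rw [map_sum, Finset.sum_eq_single j]
    · intro i _ hij
      exact hμ.form_eq_zero_of_lt (fun h => hij (Fin.ext h.symm)) hf (hb i)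
    · simp
  have key2 : ∀ f ∈ orthSpace μ j, hμ.form f (c j - c' j) = 0 := by
    intro f hf
    rw [map_sub, key c hc f hf, key c' hc' f hf, h, sub_self]
  rw [← form_apply hμ, LinearMap.map_sub₂, key2 _ (hc j), key2 _ (hc' j), sub_zero]

theorem isOrthDecomp_iff (hμ : IsPolyMeasure X μ) {d : ℕ} {p : MvPolynomial (Fin n) ℝ}
    {c : Fin (d + 1) → MvPolynomial (Fin n) ℝ} :
    IsOrthDecomp X μ d p c ↔ (∀ k : Fin (d + 1), c k ∈ orthSpace μ k) ∧ p = ∑ k, c k := by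
  refine and_congr_right fun _ => ⟨fun h => hμ.eq_of_eqOn fun x hx => ?_, fun h x _ => ?_⟩
  · rw [h x hx, map_sum]
  · rw [h, map_sum]

theorem existsUnique_decomp (hμ : IsPolyMeasure X μ) {d : ℕ} {p : MvPolynomial (Fin n) ℝ}
    (hp : p.totalDegree ≤ d) :
    ∃! c : Fin (d + 1) → MvPolynomial (Fin n) ℝ, IsOrthDecomp X μ d p c := by
  obtain ⟨c, hc, hs⟩ := hμ.exists_decomp d p hp
  refine ⟨c, hμ.isOrthDecomp_iff.2 ⟨hc, hs⟩, fun c' hc' => ?_⟩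
  replace hc' := hμ.isOrthDecomp_iff.1 hc'
  exact hμ.decomp_unique hc'.1 hc (hc'.2.symm.trans hs)

theorem form_self_decomp (hμ : IsPolyMeasure X μ) {d : ℕ}
    {c : Fin (d + 1) → MvPolynomial (Fin n) ℝ} (hc : ∀ k : Fin (d + 1), c k ∈ orthSpace μ k) :
    hμ.form (∑ k, c k) (∑ k, c k) = ∑ k, hμ.form (c k) (c k) := by
  rw [LinearMap.map_sum₂]
  refine Finset.sum_congr rfl fun i _ => ?_
  rw [map_sum, Finset.sum_eq_single i]
  · intro j _ hij
    exact hμ.form_eq_zero_of_lt (fun h => hij (Fin.ext h.symm)) (hc i) (hc j)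
  · simp

theorem abs_eval_le (hX : IsCompact X) (p : MvPolynomial (Fin n) ℝ) {x : Fin n → ℝ}
    (hx : x ∈ X) : |MvPolynomial.eval x p| ≤ supNormOn X p :=
  le_csSup (hX.bddAbove_image (MvPolynomial.continuous_eval p).abs.continuousOn)
    (Set.mem_image_of_mem _ hx)

theorem exists_supNormOn_eq (hμ : IsPolyMeasure X μ) (p : MvPolynomial (Fin n) ℝ) :
    ∃ x ∈ X, supNormOn X p = |MvPolynomial.eval x p| :=
  hμ.isCompact.exists_sSup_image_eq hμ.nonempty (MvPolynomial.continuous_eval p).abs.continuousOn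

theorem form_self_le (hμ : IsPolyMeasure X μ) (p : MvPolynomial (Fin n) ℝ) :
    hμ.form p p ≤ supNormOn X p ^ 2 := by
  have := hμ.isProbabilityMeasure
  have h1 : ∫ _x : Fin n → ℝ, supNormOn X p ^ 2 ∂μ = supNormOn X p ^ 2 := by simp
  rw [← h1, form_apply]
  refine integral_mono_ae (hμ.integrable
    ((MvPolynomial.continuous_eval p).mul (MvPolynomial.continuous_eval p)))
    (integrable_const _) ?_
  filter_upwards [hμ.ae_mem] with x hx
  rw [← sq, ← sq_abs]
  exact pow_le_pow_left₀ (abs_nonneg _) (abs_eval_le hμ.isCompact p hx) 2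

theorem supNormOn_pos (hμ : IsPolyMeasure X μ) {p : MvPolynomial (Fin n) ℝ}
    (h : ∃ x ∈ X, MvPolynomial.eval x p ≠ 0) : 0 < supNormOn X p := by
  obtain ⟨x, hx, h⟩ := h
  exact (abs_pos.2 h).trans_le (abs_eval_le hμ.isCompact p hx)

/-- The chain `‖p_k‖_X² ≤ M ‖p_k‖₂² ≤ M ‖p‖₂² ≤ M ‖p‖_X²`. -/
theorem sq_le_of_mem_harmonicRatios (hμ : IsPolyMeasure X μ) {d : ℕ} {M : ℝ}
    (hM : ∀ k ≤ d, ∀ q ∈ orthSpace μ k, ∀ x ∈ X, MvPolynomial.eval x q ^ 2 ≤ M * hμ.form q q)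
    {r : ℝ} (hr : r ∈ harmonicRatios X μ d) : r ^ 2 ≤ M := by
  obtain ⟨p, c, k, -, hp0, hc, rfl⟩ := hr
  rw [hμ.isOrthDecomp_iff] at hc
  have hS := hμ.supNormOn_pos hp0
  -- Test the hypothesis on the constant `1 ∈ H_0`.
  have hM0 : 0 ≤ M := by
    obtain ⟨x, hx⟩ := hμ.nonempty
    have := hμ.isProbabilityMeasure
    have h1 := hM 0 (Nat.zero_le _) 1 ⟨by simp, by simp⟩ x hx
    simp only [form_apply, map_one, mul_one, integral_const, probReal_univ, one_pow,
      smul_eq_mul] at h1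
    linarith
  have h1 : hμ.form (c k) (c k) ≤ supNormOn X p ^ 2 := by
    refine le_trans ?_ (hμ.form_self_le p)
    conv_rhs => rw [hc.2, hμ.form_self_decomp hc.1]
    exact Finset.single_le_sum (f := fun k => hμ.form (c k) (c k))
      (fun i _ => hμ.form_self_nonneg _) (Finset.mem_univ k)
  obtain ⟨x, hx, hxe⟩ := hμ.exists_supNormOn_eq (c k)
  rw [div_pow, div_le_iff₀ (by positivity), hxe, sq_abs]
  exact (hM k (Nat.lt_succ_iff.1 k.isLt) _ (hc.1 k) x hx).trans
    (mul_le_mul_of_nonneg_left h1 hM0)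

end IsPolyMeasure

/-- By homogeneity it suffices to maximize on the unit sphere of `N`, which is compact in finite
dimension, and then over the finite index set. -/
theorem exists_max_norm_ratio {V ι : Type*} [AddCommGroup V] [Module ℝ V] [FiniteDimensional ℝ V]
    [Nontrivial V] [Finite ι] [Nonempty ι] (N : Seminorm ℝ V) (hN : ∀ v, N v = 0 → v = 0)
    (T : ι → V →ₗ[ℝ] V) :
    ∃ i v, v ≠ 0 ∧ ∀ j w, w ≠ 0 → N (T j w) / N w ≤ N (T i v) / N v := by
  let : Norm V := ⟨N⟩
  have core : NormedSpace.Core ℝ V :=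
    { norm_nonneg := fun v => apply_nonneg N v
      norm_smul := fun a v => map_smul_eq_mul N a v
      norm_triangle := fun v w => map_add_le_add N v w
      norm_eq_zero_iff := fun v => ⟨hN v, fun h => by rw [h]; exact map_zero N⟩ }
  let : NormedAddCommGroup V := NormedAddCommGroup.ofCore core
  let : NormedSpace ℝ V := NormedSpace.ofCore core
  have hNe : ∀ v, N v = ‖v‖ := fun v => rfl
  have := FiniteDimensional.proper_real V
  have hne : (Metric.sphere (0 : V) 1).Nonempty := NormedSpace.sphere_nonempty.2 zero_le_one
  have h1 : ∀ j, ∃ v ∈ Metric.sphere (0 : V) 1, ∀ w ∈ Metric.sphere (0 : V) 1,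
      ‖T j w‖ ≤ ‖T j v‖ := fun j =>
    (isCompact_sphere (0 : V) 1).exists_isMaxOn hne
      (LinearMap.continuous_of_finiteDimensional (T j)).norm.continuousOn
  choose v hv hmax using h1
  obtain ⟨i, hi⟩ := Finite.exists_max fun j => ‖T j (v j)‖
  have hvi : ‖v i‖ = 1 := mem_sphere_zero_iff_norm.1 (hv i)
  refine ⟨i, v i, fun h => by simp [h] at hvi, fun j w hw => ?_⟩
  have hw' : 0 < ‖w‖ := norm_pos_iff.2 hw
  rw [hNe, hNe, hNe, hNe, hvi, div_one]
  refine le_trans ?_ (hi j)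
  have h2 := hmax j (‖w‖⁻¹ • w) (by simp [norm_smul, hw'.ne'])
  rwa [map_smul, norm_smul, norm_inv, norm_norm, inv_mul_eq_div] at h2

namespace IsPolyMeasure

variable {n : ℕ} {X : Set (Fin n → ℝ)} {μ : Measure (Fin n → ℝ)}

open scoped Pointwise in
/-- The maximum norm on `X`, as a seminorm on polynomials of degree at most `d`. -/
def supSeminorm (hμ : IsPolyMeasure X μ) (d : ℕ) :
    Seminorm ℝ (MvPolynomial.restrictTotalDegree (Fin n) ℝ d) :=
  Seminorm.of (fun p => supNormOn X p.1)
    (fun p q => by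
      obtain ⟨x, hx, h⟩ := hμ.exists_supNormOn_eq (p + q).1
      rw [h, Submodule.coe_add, map_add]
      exact (abs_add_le _ _).trans
        (add_le_add (abs_eval_le hμ.isCompact _ hx) (abs_eval_le hμ.isCompact _ hx)))
    (fun a p => by
      have h1 : ((fun x => |MvPolynomial.eval x (a • p).1|) '' X) =
          ‖a‖ • ((fun x => |MvPolynomial.eval x p.1|) '' X) := by
        rw [← Set.image_smul, Set.image_image]
        simp [abs_mul]
      rw [supNormOn, h1, Real.sSup_smul_of_nonneg (norm_nonneg a), smul_eq_mul, supNormOn])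

/-- Uniqueness of the decomposition makes `p ↦ p_k` linear on polynomials of degree at most `d`,
where the sup norm is a genuine norm. So `exists_max_norm_ratio` applies. -/
theorem isGreatest_harmonicConst (hμ : IsPolyMeasure X μ) (d : ℕ) :
    IsGreatest (harmonicRatios X μ d) (harmonicConst X μ d) := by
  suffices h : ∃ r, IsGreatest (harmonicRatios X μ d) r by
    obtain ⟨r, hr⟩ := h
    rw [harmonicConst, hr.csSup_eq]
    exact hr
  set V := MvPolynomial.restrictTotalDegree (Fin n) ℝ d
  have hV : ∀ p : V, p.1.totalDegree ≤ d := fun p =>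
    (MvPolynomial.mem_restrictTotalDegree _ _ _).1 p.2
  choose c hc hsum using fun p : V => hμ.exists_decomp d p.1 (hV p)
  have hdeg : ∀ p k, c p k ∈ V := fun p k => by
    rw [MvPolynomial.mem_restrictTotalDegree]
    exact (hc p k).1.trans (Nat.lt_succ_iff.1 k.isLt)
  have hadd : ∀ {k : ℕ} {p q : MvPolynomial (Fin n) ℝ}, p ∈ orthSpace μ k → q ∈ orthSpace μ k →
      p + q ∈ orthSpace μ k := fun {k p q} hp hq =>
    ⟨(MvPolynomial.totalDegree_add _ _).trans (max_le hp.1 hq.1), fun f hf => by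
      have h1 : hμ.form p f = 0 := hp.2 f hf
      have h2 : hμ.form q f = 0 := hq.2 f hf
      rw [← form_apply hμ, map_add, LinearMap.add_apply, h1, h2, add_zero]⟩
  have hsmul : ∀ {k : ℕ} (a : ℝ) {p : MvPolynomial (Fin n) ℝ}, p ∈ orthSpace μ k →
      a • p ∈ orthSpace μ k := fun {k} a {p} hp =>
    ⟨(MvPolynomial.totalDegree_smul_le _ _).trans hp.1, fun f hf => by
      have h1 : hμ.form p f = 0 := hp.2 f hf
      rw [← form_apply hμ, map_smul, LinearMap.smul_apply, h1, smul_zero]⟩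
  have hcadd : ∀ p q, c (p + q) = c p + c q := fun p q =>
    hμ.decomp_unique (hc _) (fun k => hadd (hc p k) (hc q k)) (by
      simp only [Pi.add_apply, Finset.sum_add_distrib, ← hsum, Submodule.coe_add])
  have hcsmul : ∀ (a : ℝ) p, c (a • p) = a • c p := fun a p =>
    hμ.decomp_unique (hc _) (fun k => hsmul a (hc p k)) (by
      simp only [Pi.smul_apply, ← Finset.smul_sum, ← hsum, Submodule.coe_smul])
  let T : Fin (d + 1) → V →ₗ[ℝ] V := fun k =>
    { toFun := fun p => ⟨c p k, hdeg p k⟩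
      map_add' := fun p q => Subtype.ext (by simp [hcadd])
      map_smul' := fun a p => Subtype.ext (by simp [hcsmul]) }
  have hone : (1 : MvPolynomial (Fin n) ℝ) ∈ V := by
    rw [MvPolynomial.mem_restrictTotalDegree]
    simp
  have : Nontrivial V := ⟨⟨⟨1, hone⟩, 0, fun h => one_ne_zero (congrArg Subtype.val h)⟩⟩
  have hne : ∀ p : V, p ≠ 0 ↔ ∃ x ∈ X, MvPolynomial.eval x p.1 ≠ 0 := by
    refine fun p => ⟨fun h => ?_, fun ⟨x, _, hx⟩ h => hx (by simp [h])⟩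
    by_contra! h2
    exact h (Subtype.ext (hμ.eq_of_eqOn fun x hx => by simpa using h2 x hx))
  obtain ⟨i, v, hv, hmax⟩ := exists_max_norm_ratio (hμ.supSeminorm d) (fun p hp => by
    by_contra h
    exact (hμ.supNormOn_pos ((hne p).1 h)).ne' hp) T
  refine ⟨supNormOn X (c v i) / supNormOn X v.1, ⟨v.1, c v, i, hV v, (hne v).1 hv,
    hμ.isOrthDecomp_iff.2 ⟨hc v, hsum v⟩, rfl⟩, ?_⟩
  rintro r ⟨p, b, k, hp, hp0, hb, rfl⟩
  rw [hμ.isOrthDecomp_iff] at hb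
  have hpV : p ∈ V := (MvPolynomial.mem_restrictTotalDegree _ _ _).2 hp
  have hbc : b = c ⟨p, hpV⟩ := hμ.decomp_unique hb.1 (hc _) (hb.2.symm.trans (hsum ⟨p, hpV⟩))
  rw [hbc]
  exact hmax k ⟨p, hpV⟩ ((hne ⟨p, hpV⟩).2 hp0)

theorem harmonicConst_sq_le (hμ : IsPolyMeasure X μ) {d : ℕ} {M : ℝ}
    (hM : ∀ k ≤ d, ∀ q ∈ orthSpace μ k, ∀ x ∈ X, MvPolynomial.eval x q ^ 2 ≤ M * hμ.form q q) :
    harmonicConst X μ d ^ 2 ≤ M :=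
  hμ.sq_le_of_mem_harmonicRatios hM (hμ.isGreatest_harmonicConst d).1

end IsPolyMeasure

end

/-! ### Means over the sphere and the reproducing property of zonal polynomials. -/

noncomputable section

open MvPolynomial (eval monomial pderiv IsHomogeneous)

/-- The point of the upper hemisphere above the point `x` of the unit ball. -/
def spherePoint {n : ℕ} (x : Fin n → ℝ) : Fin (n + 1) → ℝ :=
  Fin.cons √(1 - ∑ i, x i ^ 2) x

/-- The point of the lower hemisphere below the point `x` of the unit ball. -/
def spherePoint' {n : ℕ} (x : Fin n → ℝ) : Fin (n + 1) → ℝ :=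
  Fin.cons (-√(1 - ∑ i, x i ^ 2)) x

theorem continuous_spherePoint {n : ℕ} : Continuous (spherePoint (n := n)) :=
  Continuous.finCons (by fun_prop) continuous_id

theorem continuous_spherePoint' {n : ℕ} : Continuous (spherePoint' (n := n)) :=
  Continuous.finCons (by fun_prop) continuous_id

/-- The mean value of `f` at the two points of the sphere over the point `x` of the unit ball. -/
def hemisphereMean {n : ℕ} (x : Fin n → ℝ) (f : MvPolynomial (Fin (n + 1)) ℝ) : ℝ :=
  (eval (spherePoint x) f + eval (spherePoint' x) f) / 2

theorem continuous_hemisphereMean {n : ℕ} (f : MvPolynomial (Fin (n + 1)) ℝ) :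
    Continuous fun x => hemisphereMean x f :=
  (((MvPolynomial.continuous_eval f).comp continuous_spherePoint).add
    ((MvPolynomial.continuous_eval f).comp continuous_spherePoint')).div_const 2

/-- The mean value of polynomials over the sphere `Sⁿ`. -/
def sphereMean (n : ℕ) : MvPolynomial (Fin (n + 1)) ℝ →ₗ[ℝ] ℝ where
  toFun f := ∫ x, hemisphereMean x f ∂(ballMeasure n)
  map_add' f g := by
    rw [← integral_add ((isPolyMeasure_ball n).integrable (continuous_hemisphereMean f))
      ((isPolyMeasure_ball n).integrable (continuous_hemisphereMean g))]
    congr 1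
    ext x
    simp only [hemisphereMean, map_add]
    ring
  map_smul' a f := by
    rw [RingHom.id_apply, smul_eq_mul, ← integral_const_mul]
    congr 1
    ext x
    simp only [hemisphereMean, MvPolynomial.smul_eval]
    ring

theorem sphereMean_apply {n : ℕ} (f : MvPolynomial (Fin (n + 1)) ℝ) :
    sphereMean n f = ∫ x, hemisphereMean x f ∂(ballMeasure n) := rfl

theorem sphereMean_congr {n : ℕ} {f : MvPolynomial (Fin (n + 1)) ℝ} {g : (Fin n → ℝ) → ℝ}
    (h : ∀ x ∈ unitBall n, hemisphereMean x f = g x) :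
    sphereMean n f = ∫ x, g x ∂(ballMeasure n) :=
  integral_congr_ae ((isPolyMeasure_ball n).ae_mem.mono h)

theorem sq_sqrt_of_mem_unitBall {n : ℕ} {x : Fin n → ℝ} (hx : x ∈ unitBall n) :
    √(1 - ∑ i, x i ^ 2) ^ 2 = 1 - ∑ i, x i ^ 2 := Real.sq_sqrt (sub_nonneg.2 hx)

theorem sum_sq_spherePoint {n : ℕ} {x : Fin n → ℝ} (hx : x ∈ unitBall n) :
    ∑ i, spherePoint x i ^ 2 = 1 := by
  simp [spherePoint, Fin.sum_univ_succ, sq_sqrt_of_mem_unitBall hx]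

theorem sum_sq_spherePoint' {n : ℕ} {x : Fin n → ℝ} (hx : x ∈ unitBall n) :
    ∑ i, spherePoint' x i ^ 2 = 1 := by
  simp [spherePoint', Fin.sum_univ_succ, sq_sqrt_of_mem_unitBall hx]

theorem eval_monomial_one {σ : Type*} [Fintype σ] (α : σ →₀ ℕ) (u : σ → ℝ) :
    eval u (monomial α (1 : ℝ)) = ∏ i, u i ^ α i := by
  rw [MvPolynomial.eval_monomial, one_mul, Finsupp.prod_fintype _ _ fun _ => pow_zero _]

theorem hemisphereMean_monomial_of_odd {n : ℕ} (x : Fin n → ℝ) {α : Fin (n + 1) →₀ ℕ}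
    (h : Odd (α 0)) : hemisphereMean x (monomial α (1 : ℝ)) = 0 := by
  simp [hemisphereMean, eval_monomial_one, Fin.prod_univ_succ, spherePoint, spherePoint',
    h.neg_pow]

theorem hemisphereMean_monomial_of_even {n : ℕ} {x : Fin n → ℝ} (hx : x ∈ unitBall n)
    {α : Fin (n + 1) →₀ ℕ} {j : ℕ} (h : α 0 = 2 * j) :
    hemisphereMean x (monomial α (1 : ℝ)) =
      (∏ i, x i ^ α (Fin.succ i)) * (1 - ∑ i, x i ^ 2) ^ j := by
  simp only [hemisphereMean, eval_monomial_one, Fin.prod_univ_succ, spherePoint, spherePoint',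
    Fin.cons_zero, Fin.cons_succ, h, pow_mul, neg_sq, sq_sqrt_of_mem_unitBall hx]
  ring

theorem sphereMean_monomial_of_odd {n : ℕ} {α : Fin (n + 1) →₀ ℕ} {i : Fin (n + 1)}
    (hi : Odd (α i)) : sphereMean n (monomial α 1) = 0 := by
  rcases Nat.even_or_odd (α 0) with h0 | h0
  · obtain ⟨j, hj⟩ := h0.two_dvd
    rw [sphereMean_congr fun x hx => hemisphereMean_monomial_of_even hx hj]
    refine Fin.cases (fun hi => ?_) (fun i hi => ?_) i hi
    · exact absurd h0 (Nat.not_even_iff_odd.2 hi)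
    · exact integral_ball_odd (fun i => α (Fin.succ i)) j hi
  · rw [sphereMean_congr fun x _ => hemisphereMean_monomial_of_odd x h0, integral_zero]

/-- The formula is symmetric in all `n + 1` coordinates although `sphereMean` singles out coordinate
`0`: the power `(1 - ‖x‖²) ^ a 0` contributes `Γ(a 0 + 1/2)`, just like the other coordinates. -/
theorem sphereMean_monomial_even {n : ℕ} (a : Fin (n + 1) →₀ ℕ) :
    sphereMean n (monomial (2 • a) 1) =
      (∏ i, Real.Gamma (a i + 1 / 2)) / Real.Gamma (∑ i, (a i : ℝ) + (n + 1) / 2) /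
        dirichletValue (fun _ : Fin n => 0) (1 / 2) := by
  rw [sphereMean_congr fun x hx => hemisphereMean_monomial_of_even hx (j := a 0) (by simp)]
  have h := integral_ball_even (fun i => a (Fin.succ i)) (a 0)
  simp only [Finsupp.smul_apply, smul_eq_mul]
  rw [h]
  congr 1
  rw [dirichletValue, Fin.prod_univ_succ, Fin.sum_univ_succ]
  congr 2
  ring

theorem sphereMean_monomial_step {n : ℕ} (b : Fin (n + 1) →₀ ℕ) (i : Fin (n + 1)) :
    (∑ j, (b j : ℝ) + (n + 1) / 2) * sphereMean n (monomial (2 • (b + Finsupp.single i 1)) 1) =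
      (b i + 1 / 2) * sphereMean n (monomial (2 • b) 1) := by
  rw [sphereMean_monomial_even, sphereMean_monomial_even]
  have hs : ∑ j, (((b + Finsupp.single i 1 : Fin (n + 1) →₀ ℕ) j : ℕ) : ℝ) + (n + 1) / 2 =
      (∑ j, (b j : ℝ) + (n + 1) / 2) + 1 := by
    simp only [Finsupp.add_apply, Nat.cast_add, Finset.sum_add_distrib]
    have : ∑ j, ((Finsupp.single i 1 j : ℕ) : ℝ) = 1 := by
      rw [Finset.sum_eq_single i]
      · simp
      · intro j _ hj
        simp [hj.symm]
      · simp
    rw [this]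
    ring
  have hp : ∏ j, Real.Gamma (((b + Finsupp.single i 1 : Fin (n + 1) →₀ ℕ) j : ℕ) + 1 / 2) =
      (b i + 1 / 2) * ∏ j, Real.Gamma (b j + 1 / 2) := by
    rw [← Finset.mul_prod_erase _ _ (Finset.mem_univ i),
      ← Finset.mul_prod_erase _ (fun j => Real.Gamma (b j + 1 / 2)) (Finset.mem_univ i),
      ← mul_assoc]
    congr 1
    · rw [← Real.Gamma_add_one (by positivity)]
      simp only [Finsupp.add_apply, Finsupp.single_eq_same]
      push_cast
      congr 1
      ring
    · refine Finset.prod_congr rfl fun j hj => ?_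
      simp [(Finset.ne_of_mem_erase hj).symm]
  have hpos : 0 < ∑ j, (b j : ℝ) + (n + 1) / 2 := by positivity
  have hG := Real.Gamma_pos_of_pos hpos
  have hD := dirichletValue_pos (fun _ : Fin n => 0) (c := 1 / 2) (by norm_num)
  rw [hs, hp, Real.Gamma_add_one hpos.ne']
  field_simp

/-- Integration by parts on the sphere, for monomials. -/
theorem sphereMean_X_mul_monomial {n : ℕ} (α : Fin (n + 1) →₀ ℕ) (i : Fin (n + 1)) :
    ((n : ℝ) + α.degree) * sphereMean n (MvPolynomial.X i * monomial α 1) =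
      sphereMean n (pderiv i (monomial α 1)) := by
  have hX : MvPolynomial.X i * monomial α (1 : ℝ) = monomial (α + Finsupp.single i 1) 1 := by
    rw [MvPolynomial.X, MvPolynomial.monomial_mul, one_mul, add_comm α]
  have hd : pderiv i (monomial α (1 : ℝ)) =
      (α i : ℝ) • monomial (α - Finsupp.single i 1) 1 := by
    rw [MvPolynomial.pderiv_monomial, one_mul, MvPolynomial.smul_monomial, smul_eq_mul, mul_one]
  rw [hX, hd, map_smul, smul_eq_mul]
  -- If an exponent is odd, both sides vanish, since `α - eᵢ` has the parities of `α + eᵢ`; when `α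
  -- i = 0`, where the subtraction truncates, the coefficient `α i` is zero. Otherwise `α = 2 • b +
  -- eᵢ` and the claim is twice `sphereMean_monomial_step`.
  by_cases h : ∃ j, Odd ((α + Finsupp.single i 1 : Fin (n + 1) →₀ ℕ) j)
  · obtain ⟨j, hj⟩ := h
    rw [sphereMean_monomial_of_odd hj, mul_zero]
    by_cases h0 : α i = 0
    · simp [h0]
    · rw [sphereMean_monomial_of_odd (i := j), mul_zero]
      rw [Finsupp.tsub_apply]
      rw [Finsupp.add_apply] at hj
      by_cases hij : j = i
      · subst hij
        simp only [Finsupp.single_eq_same] at hj ⊢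
        rcases hj with ⟨m, hm⟩
        exact ⟨m - 1, by omega⟩
      · simpa [Finsupp.single_apply, Ne.symm hij] using hj
  · push Not at h
    have hev : ∀ j, Even ((α + Finsupp.single i 1 : Fin (n + 1) →₀ ℕ) j) := fun j => Nat.not_odd_iff_even.1 (h j)
    have hi : Odd (α i) := by
      have := hev i
      simp only [Finsupp.add_apply, Finsupp.single_eq_same] at this
      rcases this with ⟨m, hm⟩
      exact ⟨m - 1, by omega⟩
    set b : Fin (n + 1) →₀ ℕ := (α - Finsupp.single i 1).mapRange (· / 2) (by simp) with hb
    have h1 : α - Finsupp.single i 1 = 2 • b := by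
      ext j
      simp only [hb, Finsupp.tsub_apply, Finsupp.smul_apply, Finsupp.mapRange_apply, smul_eq_mul]
      have h2 := hev j
      rw [Finsupp.add_apply] at h2
      by_cases hij : j = i
      · subst hij
        simp only [Finsupp.single_eq_same] at h2 ⊢
        rcases hi with ⟨m, hm⟩
        omega
      · simp only [Finsupp.single_apply, Ne.symm hij, if_false, add_zero, Nat.sub_zero] at h2 ⊢
        rcases h2 with ⟨m, hm⟩
        omega
    have h3 : α = 2 • b + Finsupp.single i 1 := by
      rw [← h1, tsub_add_cancel_of_le]
      rw [Finsupp.single_le_iff]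
      exact hi.pos
    have h4 : α + Finsupp.single i 1 = 2 • (b + Finsupp.single i 1) := by
      rw [h3, smul_add, two_nsmul (Finsupp.single i 1)]
      abel
    have h5 : (α.degree : ℝ) = 2 * ∑ j, (b j : ℝ) + 1 := by
      rw [h3, map_add, map_nsmul, Finsupp.degree_single, Finsupp.degree_eq_sum]
      push_cast
      rw [nsmul_eq_mul]
      push_cast
      rfl
    have h6 : (α i : ℝ) = 2 * b i + 1 := by
      rw [h3]
      simp
    rw [h1, h4, h5, h6]
    linear_combination 2 * sphereMean_monomial_step b i

/-- The derivative in the direction `e`. -/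
def dirDeriv {n : ℕ} (e : Fin n → ℝ) :
    Derivation ℝ (MvPolynomial (Fin n) ℝ) (MvPolynomial (Fin n) ℝ) :=
  ∑ i, e i • pderiv i

theorem dirDeriv_apply {n : ℕ} (e : Fin n → ℝ) (f : MvPolynomial (Fin n) ℝ) :
    dirDeriv e f = ∑ i, e i • pderiv i f := by
  have h : ((∑ i, e i • pderiv i : Derivation ℝ (MvPolynomial (Fin n) ℝ) (MvPolynomial (Fin n) ℝ))
      : MvPolynomial (Fin n) ℝ → MvPolynomial (Fin n) ℝ) = ∑ i, ⇑(e i • pderiv i) :=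
    map_sum Derivation.coeFnAddMonoidHom _ _
  rw [dirDeriv, h, Finset.sum_apply]
  rfl

/-- The linear form `⟨e, ·⟩`. -/
def linForm {n : ℕ} (e : Fin n → ℝ) : MvPolynomial (Fin n) ℝ := ∑ i, e i • MvPolynomial.X i

theorem isHomogeneous_linForm {n : ℕ} (e : Fin n → ℝ) : (linForm e).IsHomogeneous 1 := by
  refine IsHomogeneous.sum _ _ _ fun i _ => ?_
  rw [MvPolynomial.smul_eq_C_mul]
  exact (MvPolynomial.isHomogeneous_X ℝ i).C_mul _

theorem isHomogeneous_linForm_pow {n : ℕ} (e : Fin n → ℝ) (k : ℕ) :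
    (linForm e ^ k).IsHomogeneous k := by
  simpa using (isHomogeneous_linForm e).pow k

theorem dirDeriv_linForm {n : ℕ} (e : Fin n → ℝ) :
    dirDeriv e (linForm e) = MvPolynomial.C (∑ i, e i ^ 2) := by
  classical
  simp only [dirDeriv_apply, linForm, map_sum, Derivation.map_smul, MvPolynomial.pderiv_X]
  refine Finset.sum_congr rfl fun i _ => ?_
  rw [Finset.sum_eq_single i]
  · simp [MvPolynomial.smul_eq_C_mul, sq]
  · intro j _ hj
    simp [hj]
  · simp

theorem IsHomogeneous.dirDeriv {n k : ℕ} {f : MvPolynomial (Fin n) ℝ} (hf : f.IsHomogeneous k)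
    (e : Fin n → ℝ) : (dirDeriv e f).IsHomogeneous (k - 1) := by
  rw [dirDeriv_apply]
  refine IsHomogeneous.sum _ _ _ fun i _ => ?_
  rw [MvPolynomial.smul_eq_C_mul]
  exact hf.pderiv.C_mul _

/-- Euler's identity. -/
theorem eval_dirDeriv_self {n k : ℕ} {f : MvPolynomial (Fin n) ℝ} (hf : f.IsHomogeneous k)
    (e : Fin n → ℝ) : eval e (dirDeriv e f) = k * eval e f := by
  have h := congrArg (eval e) hf.sum_X_mul_pderiv
  simpa [dirDeriv_apply, MvPolynomial.smul_eval] using h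

/-- Integration by parts on the sphere. -/
theorem sphereMean_linForm_mul {n m : ℕ} {f : MvPolynomial (Fin (n + 1)) ℝ}
    (hf : f.IsHomogeneous m) (e : Fin (n + 1) → ℝ) :
    ((n : ℝ) + m) * sphereMean n (linForm e * f) = sphereMean n (dirDeriv e f) := by
  have key : ∀ i, ((n : ℝ) + m) * sphereMean n (MvPolynomial.X i * f) =
      sphereMean n (pderiv i f) := by
    intro i
    rw [f.as_sum, Finset.mul_sum, map_sum, map_sum, map_sum, Finset.mul_sum]
    refine Finset.sum_congr rfl fun α hα => ?_
    have hdeg : α.degree = m := by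
      by_contra hne
      exact (MvPolynomial.mem_support_iff.1 hα) (hf.coeff_eq_zero hne)
    have hm : monomial α (MvPolynomial.coeff α f) =
        MvPolynomial.coeff α f • monomial α (1 : ℝ) := by
      rw [MvPolynomial.smul_monomial, smul_eq_mul, mul_one]
    rw [hm, Derivation.map_smul, mul_smul_comm, map_smul, map_smul, smul_eq_mul, smul_eq_mul,
      ← sphereMean_X_mul_monomial, hdeg]
    ring
  rw [linForm, dirDeriv_apply, Finset.sum_mul, map_sum, map_sum, Finset.mul_sum]
  refine Finset.sum_congr rfl fun i _ => ?_
  rw [smul_mul_assoc, map_smul, map_smul, ← key, smul_eq_mul, smul_eq_mul]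
  ring

theorem sphereMean_one (n : ℕ) : sphereMean n 1 = 1 := by
  have := (isPolyMeasure_ball n).isProbabilityMeasure
  simp [sphereMean_apply, hemisphereMean]

theorem dirDeriv_linForm_pow {n : ℕ} {e : Fin n → ℝ} (he : ∑ i, e i ^ 2 = 1) (k : ℕ) :
    dirDeriv e (linForm e ^ (k + 1)) = ((k : ℝ) + 1) • linForm e ^ k := by
  rw [Derivation.leibniz_pow, dirDeriv_linForm, he, Nat.add_sub_cancel, map_one, smul_eq_mul,
    mul_one, ← Nat.cast_smul_eq_nsmul ℝ]
  push_cast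
  rfl

/-- Integration by parts with `f = ⟨e,·⟩^(m+1)` gives the recursion of `sphereMoment`, whatever the
unit vector `e`. This takes the place of rotation invariance. -/
theorem sphereMean_linForm_pow {n : ℕ} (hn : 1 ≤ n) {e : Fin (n + 1) → ℝ}
    (he : ∑ i, e i ^ 2 = 1) (m : ℕ) : sphereMean n (linForm e ^ m) = sphereMoment n m := by
  induction m using Nat.twoStepInduction with
  | zero => rw [pow_zero, sphereMean_one, sphereMoment]
  | one =>
    have h := sphereMean_linForm_mul (MvPolynomial.isHomogeneous_one (Fin (n + 1)) ℝ) e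
    rw [Derivation.map_one_eq_zero, map_zero, mul_one, Nat.cast_zero, add_zero] at h
    rw [pow_one, sphereMoment]
    exact (mul_eq_zero.1 h).resolve_left (by positivity)
  | more m h0 h1 =>
    have h := sphereMean_linForm_mul (isHomogeneous_linForm_pow e (m + 1)) e
    rw [dirDeriv_linForm_pow he, map_smul, h0, ← pow_succ', smul_eq_mul] at h
    rw [sphereMoment, div_mul_eq_mul_div, eq_div_iff (by positivity), ← h]
    push_cast
    ring

theorem sphereMean_aeval_linForm {n : ℕ} (hn : 1 ≤ n) {e : Fin (n + 1) → ℝ}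
    (he : ∑ i, e i ^ 2 = 1) (p : Polynomial ℝ) :
    sphereMean n (Polynomial.aeval (linForm e) p) = zonalFunctional n p := by
  induction p using Polynomial.induction_on' with
  | add p q hp hq => rw [map_add, map_add, map_add, hp, hq]
  | monomial m a =>
    rw [← Polynomial.C_mul_X_pow_eq_monomial, zonalFunctional_C_mul, zonalFunctional_X_pow,
      map_mul, Polynomial.aeval_C, map_pow, Polynomial.aeval_X, ← Algebra.smul_def, map_smul,
      sphereMean_linForm_pow hn he, smul_eq_mul]

/-- Induction on `k` through integration by parts of `⟨e,·⟩ · Q⟨e,·⟩^k`. The derivative of `Q` along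
`e` satisfies the hypotheses one degree lower and, by Euler's identity, takes the value `(k + 1)
Q(e)` at `e`. The resulting factor `(k + 1) / (n + 2k + 1)` is that of `zonalFunctional_diag_succ`.
-/
theorem sphereMean_mul_linForm_pow {n : ℕ} (hn : 1 ≤ n) (e : Fin (n + 1) → ℝ) (k : ℕ) :
    ∀ Q : MvPolynomial (Fin (n + 1)) ℝ, Q.IsHomogeneous k →
      (∀ j < k, ∀ f : MvPolynomial (Fin (n + 1)) ℝ, f.IsHomogeneous j →
        sphereMean n (Q * f) = 0) →
      sphereMean n (Q * linForm e ^ k) =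
        zonalFunctional n (zonalPoly n k * Polynomial.X ^ k) * eval e Q := by
  induction k with
  | zero =>
    intro Q hQ _
    obtain ⟨a, rfl⟩ : ∃ a, Q = MvPolynomial.C a := ⟨_, MvPolynomial.totalDegree_eq_zero_iff_eq_C.1
      ((MvPolynomial.totalDegree_zero_iff_isHomogeneous _).2 hQ)⟩
    have := zonalFunctional_X_pow n 0
    rw [pow_zero, mul_one, zonalPoly, one_mul, this, sphereMoment, MvPolynomial.eval_C, one_mul,
      ← mul_one (MvPolynomial.C a), ← MvPolynomial.smul_eq_C_mul, map_smul, sphereMean_one,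
      smul_eq_mul, mul_one]
  | succ k ih =>
    intro Q hQ horth
    have hD : (dirDeriv e Q).IsHomogeneous k := by simpa using IsHomogeneous.dirDeriv hQ e
    have horth' : ∀ j < k, ∀ f : MvPolynomial (Fin (n + 1)) ℝ, f.IsHomogeneous j →
        sphereMean n (dirDeriv e Q * f) = 0 := by
      intro j hj f hf
      have h1 := sphereMean_linForm_mul (hQ.mul hf) e
      rw [mul_left_comm, horth (1 + j) (by omega) _ ((isHomogeneous_linForm e).mul hf), mul_zero,
        Derivation.leibniz, map_add, smul_eq_mul,
        horth (j - 1) (by omega) _ (IsHomogeneous.dirDeriv hf e), zero_add, smul_eq_mul,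
        mul_comm] at h1
      exact h1.symm
    have h1 := sphereMean_linForm_mul (hQ.mul (isHomogeneous_linForm_pow e k)) e
    -- The other half of the product rule pairs `Q`, of degree `k + 1`, with something of degree
    -- below `k`, or with `0` when `k = 0`.
    have h2 : sphereMean n (Q * dirDeriv e (linForm e ^ k)) = 0 := by
      rcases Nat.eq_zero_or_pos k with rfl | hk
      · simp
      · exact horth (k - 1) (by omega) _
          (IsHomogeneous.dirDeriv (isHomogeneous_linForm_pow e k) e)
    rw [Derivation.leibniz, map_add, smul_eq_mul, h2, zero_add, smul_eq_mul,
      mul_comm (linForm e ^ k), ih _ hD horth', eval_dirDeriv_self hQ, mul_left_comm,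
      ← pow_succ'] at h1
    have h3 := zonalFunctional_diag_succ hn k
    have hpos : (0 : ℝ) < n + 2 * k + 1 := by positivity
    apply mul_left_cancel₀ hpos.ne'
    push_cast at h1
    linear_combination h1 - eval e Q * h3

/-- The reproducing property: only the top power of `⟨e,·⟩` in the zonal polynomial pairs
nontrivially with `Q`. -/
theorem sphereMean_mul_zonal {n : ℕ} (hn : 1 ≤ n) (e : Fin (n + 1) → ℝ) {k : ℕ} {Q : MvPolynomial (Fin (n + 1)) ℝ} (hQ : Q.IsHomogeneous k)
    (horth : ∀ j < k, ∀ f : MvPolynomial (Fin (n + 1)) ℝ, f.IsHomogeneous j →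
      sphereMean n (Q * f) = 0) :
    sphereMean n (Q * Polynomial.aeval (linForm e) (zonalPoly n k)) =
      zonalNorm n k * eval e Q := by
  conv_lhs =>
    rw [(zonalPoly n k).as_sum_range_C_mul_X_pow' (Nat.lt_succ_of_le (zonalPoly_natDegree_le n k))]
  rw [map_sum, Finset.mul_sum, map_sum]
  have hterm : ∀ j, sphereMean n (Q * Polynomial.aeval (linForm e)
      (Polynomial.C ((zonalPoly n k).coeff j) * Polynomial.X ^ j)) =
      (zonalPoly n k).coeff j * sphereMean n (Q * linForm e ^ j) := by
    intro j
    rw [map_mul (Polynomial.aeval _), Polynomial.aeval_C, map_pow, Polynomial.aeval_X,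
      ← Algebra.smul_def, mul_smul_comm, map_smul, smul_eq_mul]
  simp only [hterm]
  rw [Finset.sum_range_succ, Finset.sum_eq_zero, zero_add,
    sphereMean_mul_linForm_pow hn e k Q hQ horth, zonalNorm_eq hn, zonalLead, mul_assoc]
  intro j hj
  rw [horth j (Finset.mem_range.1 hj) _ (isHomogeneous_linForm_pow e j), mul_zero]

theorem sphereMean_mul_self_nonneg {n : ℕ} (f : MvPolynomial (Fin (n + 1)) ℝ) :
    0 ≤ sphereMean n (f * f) := by
  refine integral_nonneg fun x => ?_
  have h1 := mul_self_nonneg (eval (spherePoint x) f)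
  have h2 := mul_self_nonneg (eval (spherePoint' x) f)
  simp only [hemisphereMean, map_mul, Pi.zero_apply]
  linarith

theorem sphereMean_mul_sq_le {n : ℕ} (f g : MvPolynomial (Fin (n + 1)) ℝ) :
    sphereMean n (f * g) ^ 2 ≤ sphereMean n (f * f) * sphereMean n (g * g) :=
  LinearMap.BilinForm.apply_sq_le_of_symm
    ((LinearMap.mul ℝ (MvPolynomial (Fin (n + 1)) ℝ)).compr₂ (sphereMean n))
    sphereMean_mul_self_nonneg ⟨fun f g => by simp [mul_comm]⟩ f g

/-- A spherical harmonic is bounded in terms of its `L²`-norm. -/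
theorem eval_sq_le_of_orthogonal {n : ℕ} (hn : 1 ≤ n) {e : Fin (n + 1) → ℝ}
    (he : ∑ i, e i ^ 2 = 1) {k : ℕ} {Q : MvPolynomial (Fin (n + 1)) ℝ} (hQ : Q.IsHomogeneous k)
    (horth : ∀ j < k, ∀ f : MvPolynomial (Fin (n + 1)) ℝ, f.IsHomogeneous j →
      sphereMean n (Q * f) = 0) :
    eval e Q ^ 2 ≤ (zonalNorm n k)⁻¹ * sphereMean n (Q * Q) := by
  -- Cauchy-Schwarz against the zonal polynomial at `e`, whose squared L² norm is `zonalNorm n k`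
  -- because `e` is a unit vector.
  have h := sphereMean_mul_sq_le Q (Polynomial.aeval (linForm e) (zonalPoly n k))
  have hpos := zonalNorm_pos hn k
  rw [sphereMean_mul_zonal hn e hQ horth, ← map_mul (Polynomial.aeval _), sphereMean_aeval_linForm hn he,
    ← zonalNorm] at h
  rw [inv_mul_eq_div, le_div_iff₀ hpos]
  apply le_of_mul_le_mul_right _ hpos
  linarith

end

/-! ### Lifting from the ball to the sphere. -/

noncomputable section

open MvPolynomial (eval monomial pderiv IsHomogeneous homogeneousComponent)

theorem integral_ball_of_odd_degree {n m : ℕ} (hm : Odd m) {f : MvPolynomial (Fin n) ℝ}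
    (hf : f.IsHomogeneous m) : ∫ x, eval x f ∂(ballMeasure n) = 0 := by
  have h1 : ∀ x : Fin n → ℝ, eval x f =
      ∑ α ∈ f.support, MvPolynomial.coeff α f * ∏ i, x i ^ α i := fun x => MvPolynomial.eval_eq' x f
  simp only [h1]
  rw [integral_finsetSum _ fun α _ => (isPolyMeasure_ball n).integrable (by fun_prop)]
  refine Finset.sum_eq_zero fun α hα => ?_
  have hdeg : α.degree = m := by
    by_contra hne
    exact (MvPolynomial.mem_support_iff.1 hα) (hf.coeff_eq_zero hne)
  have hodd : ∃ i, Odd (α i) := by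
    by_contra! h
    rw [← hdeg, Finsupp.degree_eq_sum, ← Nat.not_even_iff_odd] at hm
    exact hm (Finset.even_sum _ fun i _ => Nat.not_odd_iff_even.1 (h i))
  obtain ⟨i, hi⟩ := hodd
  rw [integral_const_mul]
  have := integral_ball_odd (fun i => α i) 0 hi
  simp only [pow_zero, mul_one] at this
  rw [this, mul_zero]

/-- An element of the `k`-th orthogonal space on the ball is the sum of its homogeneous components
of degrees of the same parity as `k`. -/
theorem eq_sum_homogeneousComponent_of_mem_orthSpace {n k : ℕ} {q : MvPolynomial (Fin n) ℝ}
    (hq : q ∈ orthSpace (ballMeasure n) k) :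
    q = ∑ j ∈ (Finset.range (k + 1)).filter (fun j => Even (k - j)), homogeneousComponent j q := by
  set hμ := isPolyMeasure_ball n
  set A := ∑ j ∈ (Finset.range (k + 1)).filter (fun j => Even (k - j)), homogeneousComponent j q
    with hA
  set B := ∑ j ∈ (Finset.range (k + 1)).filter (fun j => ¬ Even (k - j)), homogeneousComponent j q
    with hB
  have hsum : q = A + B := by
    rw [hA, hB, Finset.sum_filter_add_sum_filter_not]
    conv_lhs => rw [← MvPolynomial.sum_homogeneousComponent q]
    refine Finset.sum_subset (Finset.range_mono (Nat.succ_le_succ hq.1)) fun j _ hj => ?_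
    exact MvPolynomial.homogeneousComponent_eq_zero _ _ (by
      rw [Finset.mem_range] at hj
      omega)
  have hAB : hμ.form A B = 0 := by
    rw [hA, hB, LinearMap.map_sum₂]
    refine Finset.sum_eq_zero fun i hi => ?_
    rw [map_sum]
    refine Finset.sum_eq_zero fun j hj => ?_
    rw [Finset.mem_filter, Finset.mem_range] at hi hj
    have hodd : Odd (i + j) := by
      obtain ⟨a, ha⟩ := hi.2
      obtain ⟨b, hb⟩ := Nat.not_even_iff_odd.1 hj.2
      exact ⟨k - a - b - 1, by omega⟩
    have h := integral_ball_of_odd_degree hodd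
      ((MvPolynomial.homogeneousComponent_isHomogeneous i q).mul
        (MvPolynomial.homogeneousComponent_isHomogeneous j q))
    simpa only [IsPolyMeasure.form_apply, map_mul] using h
  -- `B` collects the components of the wrong parity, so it has no part of degree `k` and is
  -- orthogonal to `q`. It is also orthogonal to `A` by parity, hence to itself.
  have hqB : hμ.form q B = 0 := by
    rw [hB, map_sum]
    refine Finset.sum_eq_zero fun j hj => ?_
    rw [Finset.mem_filter, Finset.mem_range] at hj
    refine hq.2 _ ((MvPolynomial.homogeneousComponent_isHomogeneous j q).totalDegree_le.trans_lt ?_)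
    rcases (Nat.lt_succ_iff.1 hj.1).lt_or_eq with h | rfl
    · exact h
    · simp at hj
  have hB0 : B = 0 := by
    refine hμ.definite _ ?_
    rw [hsum, LinearMap.map_add₂, hAB, zero_add] at hqB
    exact hqB
  conv_lhs => rw [hsum, hB0, add_zero]

/-- The sum of the squares of the variables. -/
def sumSq (n : ℕ) : MvPolynomial (Fin n) ℝ := ∑ i, MvPolynomial.X i ^ 2

theorem isHomogeneous_sumSq (n : ℕ) : (sumSq n).IsHomogeneous 2 :=
  IsHomogeneous.sum _ _ _ fun i _ => MvPolynomial.isHomogeneous_X_pow i 2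

theorem eval_sumSq {n : ℕ} (x : Fin n → ℝ) : eval x (sumSq n) = ∑ i, x i ^ 2 := by
  simp [sumSq]

/-- The homogeneous polynomial of degree `k` that agrees with `q` on the sphere. -/
def sphereLift {n : ℕ} (k : ℕ) (q : MvPolynomial (Fin n) ℝ) : MvPolynomial (Fin (n + 1)) ℝ :=
  ∑ j ∈ (Finset.range (k + 1)).filter (fun j => Even (k - j)),
    MvPolynomial.rename Fin.succ (homogeneousComponent j q) * sumSq (n + 1) ^ ((k - j) / 2)

theorem isHomogeneous_sphereLift {n : ℕ} (k : ℕ) (q : MvPolynomial (Fin n) ℝ) :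
    (sphereLift k q).IsHomogeneous k := by
  refine IsHomogeneous.sum _ _ _ fun j hj => ?_
  rw [Finset.mem_filter, Finset.mem_range] at hj
  have h := (MvPolynomial.homogeneousComponent_isHomogeneous j q).rename_isHomogeneous
    (f := Fin.succ) |>.mul ((isHomogeneous_sumSq (n + 1)).pow ((k - j) / 2))
  have : j + 2 * ((k - j) / 2) = k := by
    have := Nat.two_mul_div_two_of_even hj.2
    omega
  rwa [this] at h

theorem eval_sphereLift {n k : ℕ} {q : MvPolynomial (Fin n) ℝ}
    (hq : q ∈ orthSpace (ballMeasure n) k) {s : ℝ} {x : Fin n → ℝ}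
    (hu : ∑ i, (Fin.cons s x : Fin (n + 1) → ℝ) i ^ 2 = 1) :
    eval (Fin.cons s x : Fin (n + 1) → ℝ) (sphereLift k q) = eval x q := by
  conv_rhs => rw [eq_sum_homogeneousComponent_of_mem_orthSpace hq]
  rw [sphereLift, map_sum, map_sum]
  refine Finset.sum_congr rfl fun j _ => ?_
  rw [map_mul, map_pow, eval_sumSq, hu, one_pow, mul_one, MvPolynomial.eval_rename]
  rfl

/-- The lift takes the value `q(x)` at both points over `x`, so it factors out of the mean. -/
theorem hemisphereMean_sphereLift_mul {n k : ℕ} {q : MvPolynomial (Fin n) ℝ}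
    (hq : q ∈ orthSpace (ballMeasure n) k) {x : Fin n → ℝ} (hx : x ∈ unitBall n)
    (f : MvPolynomial (Fin (n + 1)) ℝ) :
    hemisphereMean x (sphereLift k q * f) = eval x q * hemisphereMean x f := by
  have h1 : eval (spherePoint x) (sphereLift k q) = eval x q :=
    eval_sphereLift hq (sum_sq_spherePoint hx)
  have h2 : eval (spherePoint' x) (sphereLift k q) = eval x q :=
    eval_sphereLift hq (sum_sq_spherePoint' hx)
  rw [hemisphereMean, map_mul, map_mul, h1, h2, hemisphereMean]
  ring

/-- Averaging over the two signs kills odd powers of the extra coordinate, and its square becomes `1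
- ‖x‖²`. The mean is thus a polynomial in `x` of no larger degree, which carries orthogonality from
the ball to the sphere. -/
theorem exists_hemisphereMean_monomial_eq {n : ℕ} (α : Fin (n + 1) →₀ ℕ) :
    ∃ g : MvPolynomial (Fin n) ℝ, g.totalDegree ≤ α.degree ∧
      ∀ x ∈ unitBall n, hemisphereMean x (monomial α 1) = eval x g := by
  rcases Nat.even_or_odd (α 0) with h0 | h0
  · obtain ⟨j, hj⟩ := h0.two_dvd
    refine ⟨(∏ i, MvPolynomial.X i ^ α (Fin.succ i)) * (1 - sumSq n) ^ j, ?_, fun x hx => ?_⟩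
    · have h1 : (∏ i : Fin n, MvPolynomial.X (R := ℝ) i ^ α (Fin.succ i)).totalDegree ≤
          ∑ i : Fin n, α (Fin.succ i) :=
        (MvPolynomial.totalDegree_finsetProd _ _).trans
          (Finset.sum_le_sum fun i _ => by rw [MvPolynomial.totalDegree_X_pow])
      have h2 : (1 - sumSq n).totalDegree ≤ 2 :=
        (MvPolynomial.totalDegree_sub _ _).trans
          (max_le (by simp) (isHomogeneous_sumSq n).totalDegree_le)
      have h3 : ((1 - sumSq n) ^ j).totalDegree ≤ j * 2 :=
        (MvPolynomial.totalDegree_pow _ _).trans (Nat.mul_le_mul_left j h2)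
      refine (MvPolynomial.totalDegree_mul _ _).trans ?_
      rw [Finsupp.degree_eq_sum, Fin.sum_univ_succ]
      omega
    · rw [hemisphereMean_monomial_of_even hx hj]
      simp [eval_sumSq]
  · exact ⟨0, by simp, fun x _ => by rw [hemisphereMean_monomial_of_odd x h0, map_zero]⟩

theorem sphereMean_sphereLift_mul_eq_zero {n k : ℕ} {q : MvPolynomial (Fin n) ℝ}
    (hq : q ∈ orthSpace (ballMeasure n) k) {j : ℕ} (hj : j < k)
    {f : MvPolynomial (Fin (n + 1)) ℝ} (hf : f.IsHomogeneous j) :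
    sphereMean n (sphereLift k q * f) = 0 := by
  rw [f.as_sum, Finset.mul_sum, map_sum]
  refine Finset.sum_eq_zero fun α hα => ?_
  have hdeg : α.degree = j := by
    by_contra hne
    exact (MvPolynomial.mem_support_iff.1 hα) (hf.coeff_eq_zero hne)
  have hm : monomial α (MvPolynomial.coeff α f) =
      MvPolynomial.coeff α f • monomial α (1 : ℝ) := by
    rw [MvPolynomial.smul_monomial, smul_eq_mul, mul_one]
  obtain ⟨g, hg, hgx⟩ := exists_hemisphereMean_monomial_eq α
  rw [hm, mul_smul_comm, map_smul, sphereMean_congr (g := fun x => eval x q * eval x g)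
    fun x hx => by rw [hemisphereMean_sphereLift_mul hq hx, hgx x hx],
    hq.2 g (by omega), smul_zero]

/-- Elements of the `k`-th orthogonal space on the ball are bounded in terms of their
`L²`-norm. -/
theorem eval_sq_le_of_mem_orthSpace_ball {n : ℕ} (hn : 1 ≤ n) {k : ℕ}
    {q : MvPolynomial (Fin n) ℝ} (hq : q ∈ orthSpace (ballMeasure n) k) {x : Fin n → ℝ}
    (hx : x ∈ unitBall n) :
    eval x q ^ 2 ≤ (zonalNorm n k)⁻¹ * (isPolyMeasure_ball n).form q q := by
  have h := eval_sq_le_of_orthogonal hn (sum_sq_spherePoint hx) (isHomogeneous_sphereLift k q)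
    fun j hj f hf => sphereMean_sphereLift_mul_eq_zero hq hj hf
  have h1 : eval (spherePoint x) (sphereLift k q) = eval x q :=
    eval_sphereLift hq (sum_sq_spherePoint hx)
  rw [h1, sphereMean_congr (g := fun x => eval x q * eval x q) fun y hy => by
    rw [hemisphereMean_sphereLift_mul hq hy]
    have := hemisphereMean_sphereLift_mul hq hy 1
    rw [mul_one] at this
    rw [this]
    simp [hemisphereMean]] at h
  exact h

/-! ### The simplex as the image of the ball under squaring coordinates. -/

/-- Checked on monomials, where both sides are the same quotient of Dirichlet values. -/
theorem integral_simplex_eq {n : ℕ} (f : MvPolynomial (Fin n) ℝ) :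
    ∫ x, eval x f ∂(simplexMeasure n) =
      ∫ x, eval x (MvPolynomial.expand 2 f) ∂(ballMeasure n) := by
  have h1 : ∀ x : Fin n → ℝ, eval x f =
      ∑ α ∈ f.support, MvPolynomial.coeff α f * ∏ i, x i ^ α i := fun x => MvPolynomial.eval_eq' x f
  have h2 : ∀ x : Fin n → ℝ, eval x (MvPolynomial.expand 2 f) =
      ∑ α ∈ f.support, MvPolynomial.coeff α f * ∏ i, x i ^ (2 * α i) := by
    intro x
    rw [MvPolynomial.eval_expand, h1]
    simp only [Pi.pow_apply, ← pow_mul]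
  simp only [h1, h2]
  rw [integral_finsetSum _ fun α _ => (isPolyMeasure_simplex n).integrable (by fun_prop),
    integral_finsetSum _ fun α _ => (isPolyMeasure_ball n).integrable (by fun_prop)]
  refine Finset.sum_congr rfl fun α _ => ?_
  rw [integral_const_mul, integral_const_mul, integral_simplex_monomial]
  have := integral_ball_even (fun i => α i) 0
  simp only [pow_zero, mul_one, Nat.cast_zero, zero_add] at this
  rw [this]

/-- Test against monomials. One with an odd exponent integrates to zero by reflection; the others
are expansions of monomials of degree below `k`, for which orthogonality on the simplex applies. -/
theorem expand_mem_orthSpace_ball {n k : ℕ} {q : MvPolynomial (Fin n) ℝ}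
    (hq : q ∈ orthSpace (simplexMeasure n) k) :
    MvPolynomial.expand 2 q ∈ orthSpace (ballMeasure n) (2 * k) := by
  refine ⟨?_, fun f hf => ?_⟩
  · rw [MvPolynomial.totalDegree_expand, mul_comm]
    exact Nat.mul_le_mul_left 2 hq.1
  · have hform : (isPolyMeasure_ball n).form (MvPolynomial.expand 2 q) f = 0 := by
      rw [f.as_sum, map_sum]
      refine Finset.sum_eq_zero fun α hα => ?_
      have hdeg : α.degree < 2 * k := by
        refine lt_of_le_of_lt ?_ hf
        rw [Finsupp.degree_eq_sum, ← Finsupp.sum_fintype α (fun _ e => e) fun _ => rfl]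
        exact MvPolynomial.le_totalDegree hα
      have hm : monomial α (MvPolynomial.coeff α f) =
          MvPolynomial.coeff α f • monomial α (1 : ℝ) := by
        rw [MvPolynomial.smul_monomial, smul_eq_mul, mul_one]
      rw [hm, map_smul, IsPolyMeasure.form_apply, smul_eq_mul]
      refine mul_eq_zero_of_right _ ?_
      by_cases hodd : ∃ i, Odd (α i)
      · obtain ⟨i, hi⟩ := hodd
        have h := integral_ball_flipCoord i fun x =>
          eval x (MvPolynomial.expand 2 q) * eval x (monomial α (1 : ℝ))
        have hsq : ∀ x : Fin n → ℝ, flipCoord i x ^ 2 = x ^ 2 := by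
          intro x
          ext j
          by_cases h : j = i <;> simp [flipCoord, h]
        simp only [MvPolynomial.eval_expand, hsq, eval_monomial_one,
          prod_pow_flipCoord_of_odd hi, mul_neg, integral_neg] at h ⊢
        linarith
      · push Not at hodd
        set b : Fin n →₀ ℕ := α.mapRange (· / 2) (by simp) with hb
        have hab : α = 2 • b := by
          ext i
          have := Nat.two_mul_div_two_of_even (Nat.not_odd_iff_even.1 (hodd i))
          simp [hb, this]
        have hbdeg : b.degree < k := by
          rw [hab, map_nsmul, smul_eq_mul] at hdeg
          omega
        have h1 : monomial α (1 : ℝ) = MvPolynomial.expand 2 (monomial b 1) := by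
          rw [MvPolynomial.expand_monomial, hab]
        have h2 := hq.2 (monomial b 1) (by
          refine lt_of_le_of_lt ?_ hbdeg
          exact (MvPolynomial.isHomogeneous_monomial _ rfl).totalDegree_le)
        simp only [← map_mul] at h2
        rw [integral_simplex_eq, map_mul, ← h1] at h2
        simpa only [map_mul] using h2
    exact hform

/-- Elements of the `k`-th orthogonal space on the simplex are bounded in terms of their
`L²`-norm. -/
theorem eval_sq_le_of_mem_orthSpace_simplex {n : ℕ} (hn : 1 ≤ n) {k : ℕ}
    {q : MvPolynomial (Fin n) ℝ} (hq : q ∈ orthSpace (simplexMeasure n) k) {x : Fin n → ℝ}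
    (hx : x ∈ solidSimplex n) :
    eval x q ^ 2 ≤ (zonalNorm n (2 * k))⁻¹ * (isPolyMeasure_simplex n).form q q := by
  have hsq : ∀ i, √(x i) ^ 2 = x i := fun i => Real.sq_sqrt (hx.1 i)
  have hu : (fun i => √(x i)) ∈ unitBall n := by
    have : ∑ i, √(x i) ^ 2 ≤ 1 := by
      simp only [hsq]
      linarith [hx.2]
    exact this
  have h := eval_sq_le_of_mem_orthSpace_ball hn (expand_mem_orthSpace_ball hq) hu
  have hx2 : (fun i => √(x i)) ^ 2 = x := by
    ext i
    exact hsq i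
  rw [MvPolynomial.eval_expand, hx2, IsPolyMeasure.form_apply] at h
  simp only [← map_mul] at h
  rw [← integral_simplex_eq] at h
  simpa only [IsPolyMeasure.form_apply, map_mul] using h

theorem harmonicConst_ball_sq_le {n : ℕ} (hn : 1 ≤ n) {d : ℕ} {M : ℝ}
    (hM : ∀ k ≤ d, (zonalNorm n k)⁻¹ ≤ M) :
    harmonicConst (unitBall n) (ballMeasure n) d ^ 2 ≤ M :=
  (isPolyMeasure_ball n).harmonicConst_sq_le fun k hk _ hq _ hx =>
    (eval_sq_le_of_mem_orthSpace_ball hn hq hx).trans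
      (mul_le_mul_of_nonneg_right (hM k hk) (IsPolyMeasure.form_self_nonneg _ _))

theorem harmonicConst_simplex_sq_le {n : ℕ} (hn : 1 ≤ n) {d : ℕ} {M : ℝ}
    (hM : ∀ k ≤ d, (zonalNorm n (2 * k))⁻¹ ≤ M) :
    harmonicConst (solidSimplex n) (simplexMeasure n) d ^ 2 ≤ M :=
  (isPolyMeasure_simplex n).harmonicConst_sq_le fun k hk _ hq _ hx =>
    (eval_sq_le_of_mem_orthSpace_simplex hn hq hx).trans
      (mul_le_mul_of_nonneg_right (hM k hk) (IsPolyMeasure.form_self_nonneg _ _))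

/-! ### Polynomial bounds and conclusion. -/

theorem zonalNorm_inv_le_pow_left {n d k : ℕ} (hn : 1 ≤ n) (hk : k ≤ d) :
    (zonalNorm n k)⁻¹ ≤ ((n : ℝ) + d) ^ d := by
  refine (zonalNorm_inv_le hn k).trans ?_
  have h1 : (n + k).choose k ≤ (n + d) ^ d :=
    (Nat.choose_le_pow _ _).trans ((Nat.pow_le_pow_left (by omega) k).trans
      (Nat.pow_le_pow_right (by omega) hk))
  exact_mod_cast h1

theorem zonalNorm_inv_le_pow_right {n d k : ℕ} (hn : 1 ≤ n) (hk : k ≤ d) :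
    (zonalNorm n k)⁻¹ ≤ ((n : ℝ) + d) ^ n := by
  refine (zonalNorm_inv_le hn k).trans ?_
  have h1 : (n + k).choose k ≤ (n + d) ^ n := by
    rw [Nat.choose_symm_add.symm]
    exact (Nat.choose_le_pow _ _).trans (Nat.pow_le_pow_left (by omega) n)
  exact_mod_cast h1

/-- Lets a bound on the squared harmonic constant serve for the constant itself, so that no root of
a polynomial appears. -/
theorem le_of_sq_le_of_one_le {a M : ℝ} (hM : 1 ≤ M) (h : a ^ 2 ≤ M) : a ≤ M :=
  le_of_not_gt fun h1 => by nlinarith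

theorem one_le_natCast_add_pow {n : ℕ} (hn : 1 ≤ n) (d m : ℕ) : 1 ≤ ((n : ℝ) + d) ^ m := by
  refine one_le_pow₀ ?_
  exact_mod_cast (by omega : 1 ≤ n + d)

end

theorem mainTheorem5 :
    -- on the ball and the simplex the components exist and are unique, and the maximum
    -- defining the harmonic constant is attained
    (∀ n d : ℕ, 1 ≤ n →
      (∀ p : MvPolynomial (Fin n) ℝ, p.totalDegree ≤ d →
        ∃! c : Fin (d + 1) → MvPolynomial (Fin n) ℝ,
          IsOrthDecomp (unitBall n) (ballMeasure n) d p c) ∧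
      (∀ p : MvPolynomial (Fin n) ℝ, p.totalDegree ≤ d →
        ∃! c : Fin (d + 1) → MvPolynomial (Fin n) ℝ,
          IsOrthDecomp (solidSimplex n) (simplexMeasure n) d p c) ∧
      IsGreatest (harmonicRatios (unitBall n) (ballMeasure n) d)
        (harmonicConst (unitBall n) (ballMeasure n) d) ∧
      IsGreatest (harmonicRatios (solidSimplex n) (simplexMeasure n) d)
        (harmonicConst (solidSimplex n) (simplexMeasure n) d)) ∧
    -- polynomial dependence on `n` for fixed `d`
    (∀ d : ℕ, ∃ P : Polynomial ℝ, ∀ n : ℕ, 1 ≤ n →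
      harmonicConst (unitBall n) (ballMeasure n) d ≤ P.eval (n : ℝ)) ∧
    (∀ d : ℕ, ∃ P : Polynomial ℝ, ∀ n : ℕ, 1 ≤ n →
      harmonicConst (solidSimplex n) (simplexMeasure n) d ≤ P.eval (n : ℝ)) ∧
    -- polynomial dependence on `d` for fixed `n`
    (∀ n : ℕ, 1 ≤ n → ∃ P : Polynomial ℝ, ∀ d : ℕ,
      harmonicConst (unitBall n) (ballMeasure n) d ≤ P.eval (d : ℝ)) ∧
    (∀ n : ℕ, 1 ≤ n → ∃ P : Polynomial ℝ, ∀ d : ℕ,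
      harmonicConst (solidSimplex n) (simplexMeasure n) d ≤ P.eval (d : ℝ)) ∧
    -- explicit bounds
    (∀ n d : ℕ, 2 ≤ n →
      harmonicConst (unitBall n) (ballMeasure n) d ^ 2 ≤
          (Finset.range (d + 1)).sup' Finset.nonempty_range_add_one
            (fun k => (gegenbauer n k).eval 1) ∧
      harmonicConst (solidSimplex n) (simplexMeasure n) d ^ 2 ≤
          (Finset.range (d + 1)).sup' Finset.nonempty_range_add_one
            (fun k => (gegenbauer n (2 * k)).eval 1)) ∧
    -- the value of the Gegenbauer polynomials at `1`
    (∀ n k : ℕ, 2 ≤ n →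
      (gegenbauer n k).eval 1 =
        (1 + 2 * (k : ℝ) / ((n : ℝ) - 1)) * ((k + n - 2).choose k : ℝ)) := by
  refine ⟨fun n d _ => ⟨fun p hp => (isPolyMeasure_ball n).existsUnique_decomp hp,
    fun p hp => (isPolyMeasure_simplex n).existsUnique_decomp hp,
    (isPolyMeasure_ball n).isGreatest_harmonicConst d,
    (isPolyMeasure_simplex n).isGreatest_harmonicConst d⟩, fun d => ?_, fun d => ?_,
    fun n hn => ?_, fun n hn => ?_, fun n d hn => ⟨?_, ?_⟩, fun n k hn => ?_⟩
  · refine ⟨(Polynomial.X + Polynomial.C (d : ℝ)) ^ d, fun n hn => ?_⟩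
    simp only [Polynomial.eval_pow, Polynomial.eval_add, Polynomial.eval_X, Polynomial.eval_C]
    exact le_of_sq_le_of_one_le (one_le_natCast_add_pow hn d d)
      (harmonicConst_ball_sq_le hn fun k hk => zonalNorm_inv_le_pow_left hn hk)
  -- The ball polynomial with `2 * d` for `d`, since degree `k` on the simplex is degree `2 * k` on
  -- the ball.
  · refine ⟨(Polynomial.X + Polynomial.C ((2 * d : ℕ) : ℝ)) ^ (2 * d), fun n hn => ?_⟩
    simp only [Polynomial.eval_pow, Polynomial.eval_add, Polynomial.eval_X, Polynomial.eval_C]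
    exact le_of_sq_le_of_one_le (one_le_natCast_add_pow hn (2 * d) (2 * d))
      (harmonicConst_simplex_sq_le hn fun k hk => zonalNorm_inv_le_pow_left hn (by omega))
  · refine ⟨(Polynomial.C (n : ℝ) + Polynomial.X) ^ n, fun d => ?_⟩
    simp only [Polynomial.eval_pow, Polynomial.eval_add, Polynomial.eval_X, Polynomial.eval_C]
    exact le_of_sq_le_of_one_le (one_le_natCast_add_pow hn d n)
      (harmonicConst_ball_sq_le hn fun k hk => zonalNorm_inv_le_pow_right hn hk)
  · refine ⟨(Polynomial.C (n : ℝ) + Polynomial.C 2 * Polynomial.X) ^ n, fun d => ?_⟩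
    simp only [Polynomial.eval_pow, Polynomial.eval_add, Polynomial.eval_mul, Polynomial.eval_X,
      Polynomial.eval_C]
    have h : ((n : ℝ) + 2 * d) = n + (2 * d : ℕ) := by push_cast; rfl
    rw [h]
    exact le_of_sq_le_of_one_le (one_le_natCast_add_pow hn (2 * d) n)
      (harmonicConst_simplex_sq_le hn fun k hk => zonalNorm_inv_le_pow_right hn (by omega))
  · refine harmonicConst_ball_sq_le (by omega) fun k hk => ?_
    rw [← gegenbauer_eval_one_eq hn]
    exact Finset.le_sup' (fun k => (gegenbauer n k).eval 1) (Finset.mem_range_succ_iff.2 hk)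
  · refine harmonicConst_simplex_sq_le (by omega) fun k hk => ?_
    rw [← gegenbauer_eval_one_eq hn]
    exact Finset.le_sup' (fun k => (gegenbauer n (2 * k)).eval 1) (Finset.mem_range_succ_iff.2 hk)
  · rw [gegenbauer_eval_one_eq hn, zonalNorm_inv_eq hn]
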